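/- Fix a Littlewood--Paley cutoff on $\mathbb R^3$, i.e. a smooth radial function $\eta:\mathbb R^3\to[0,1]$ with $\eta(\xi)=1$ for $|\xi|\le 1$ and $\eta(\xi)=0$ for $|\xi|\ge 2$; let $P_0 u=\mathcal F^{-1}(\eta\,\mathcal F u)$ and $P_k u=\mathcal F^{-1}\big((\eta(2^{-k}\cdot)-\eta(2^{-k+1}\cdot))\,\mathcal F u\big)$ for $k\ge 1$, where $\mathcal F$ is the Fourier transform with kernel $e^{-ix\cdot\xi}$. For $s\ge 0$ put $\|u\|_{H^s(\mathbb R^3)}=\big(\sum_{k\ge 0}2^{2sk}\|P_k u\|_{L^2}^2\big)^{1/2}$, let $\|f\|_{H^s(\Omega)}$ be the infimum of $\|\bar f\|_{H^s(\mathbb R^3)}$ over all real-valued $\bar f\in H^s(\mathbb R^3)$ with $\bar f|_\Omega=f$, and let the $H^s(\Omega)$ norm of a covariant $2$-tensor be the sum of the $H^s(\Omega)$ norms of its Cartesian components. Let $B(0,1)$ be the open unit ball of $\mathbb R^3$ and $e$ the Euclidean metric. Then there exists a sequence $\{(g^{(j)},k^{(j)};\psi_0^{(j)},\psi_1^{(j)})\}_{j=1}^\infty$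 of smooth, spherically symmetric initial data sets for the Einstein--scalar field system on $B(0,1)$, i.e. of smooth Riemannian metrics $g^{(j)}$, smooth symmetric $(0,2)$-tensors $k^{(j)}$ and smooth functions $\psi_0^{(j)},\psi_1^{(j)}:B(0,1)\to\mathbb R$, all invariant under the orthogonal transformations of $\mathbb R^3$, satisfying on $B(0,1)$ the constraint equations $$R[g^{(j)}]+(\mathrm{tr}_{g^{(j)}}k^{(j)})^2-\|k^{(j)}\|_{g^{(j)}}^2=\|\nabla\psi_0^{(j)}\|_{g^{(j)}}^2+(\psi_1^{(j)})^2,$$ $$\mathrm{div}_{g^{(j)}}k^{(j)}-\nabla(\mathrm{tr}_{g^{(j)}}k^{(j)})=\psi_1^{(j)}\nabla\psi_0^{(j)},$$ such that, for every $j\ge 1$, $$\|g^{(j)}-e\|_{H^{3/2}(B(0,1))}+\|k^{(j)}\|_{H^{1/2}(B(0,1))}\le 2^{-j},$$ and $(B(0,1);g^{(j)},k^{(j)})$ contains a smooth embedded compact trapped $2$-sphere $\Sigma$. Here a compact embedded smooth surface $\Sigma$ is trapped in $(B(0,1);g,k)$ if at each of its points $\mathrm{tr}(k+h)<0$ and $\mathrm{tr}(k-h)<0$,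 where $h(X,Y)=\langle\nabla_X N,Y\rangle_g$ is the second fundamental form of $\Sigma$ with respect to a $g$-unit normal $N$, $k$ is restricted to $\Sigma$, and traces are taken with respect to the metric induced by $g$ on $\Sigma$. -/

import Mathlib

open scoped ContDiff Manifold FourierTransform ENNReal
open MeasureTheory

noncomputable section

namespace EinsteinScalar

/-- Euclidean three-space, with its Cartesian coordinates `x 0, x 1, x 2`. -/
abbrev E3 : Type := EuclideanSpace ℝ (Fin 3)

/-- A covariant `2`-tensor field on (a subset of) `ℝ³`, given by its Cartesian components. -/
abbrev Tensor2 : Type := E3 → Matrix (Fin 3) (Fin 3) ℝ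

/-- The open unit ball of `ℝ³`. -/
abbrev unitBall : Set E3 := Metric.ball (0 : E3) 1

/-! ### Littlewood–Paley decomposition and the spaces `H^s = B^s_{2,2}` -/

/-- A cutoff generating a Littlewood–Paley decomposition of `ℝ³`: a smooth radial function
`η : ℝ³ → [0,1]` equal to `1` for `|ξ| ≤ 1` and to `0` for `|ξ| ≥ 2`. -/
structure LPCutoff where
  /-- the underlying function -/
  toFun : E3 → ℝ
  smooth : ContDiff ℝ ∞ toFun
  radial : ∀ ξ ζ : E3, ‖ξ‖ = ‖ζ‖ → toFun ξ = toFun ζ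
  mem_Icc : ∀ ξ, toFun ξ ∈ Set.Icc (0 : ℝ) 1
  eq_one : ∀ ξ, ‖ξ‖ ≤ 1 → toFun ξ = 1
  eq_zero : ∀ ξ, 2 ≤ ‖ξ‖ → toFun ξ = 0

namespace LPCutoff

/-- The symbol of the projection `P_k`: `η(ξ)` for `k = 0` and
`η(2^{-k} ξ) - η(2^{-k+1} ξ)` for `k ≥ 1`. -/
def symbol (η : LPCutoff) : ℕ → E3 → ℝ
  | 0, ξ => η.toFun ξ
  | k + 1, ξ => η.toFun (((2 : ℝ) ^ (k + 1))⁻¹ • ξ) - η.toFun (((2 : ℝ) ^ k)⁻¹ • ξ)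

theorem continuous_symbol (η : LPCutoff) (k : ℕ) : Continuous (η.symbol k) := by
  have h := η.smooth.continuous
  cases k with
  | zero => exact h
  | succ k =>
    exact (h.comp (continuous_const_smul _)).sub (h.comp (continuous_const_smul _))

theorem abs_symbol_le (η : LPCutoff) (k : ℕ) (ξ : E3) : |η.symbol k ξ| ≤ 1 := by
  cases k with
  | zero =>
    have h := η.mem_Icc ξ
    exact abs_le.2 ⟨by have := h.1; simp only [symbol]; linarith, h.2⟩
  | succ k =>
    have h := η.mem_Icc (((2 : ℝ) ^ (k + 1))⁻¹ • ξ)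
    have h' := η.mem_Icc (((2 : ℝ) ^ k)⁻¹ • ξ)
    simp only [symbol]
    exact abs_le.2 ⟨by linarith [h.1, h'.2], by linarith [h.2, h'.1]⟩

theorem memLp_symbol_mul (η : LPCutoff) (k : ℕ) (f : Lp (α := E3) ℂ 2) :
    MemLp (fun w : E3 => ((η.symbol k ((2 * Real.pi) • w) : ℝ) : ℂ) * f w) 2 volume := by
  refine MemLp.of_le (Lp.memLp f) ?_ ?_
  · refine AEStronglyMeasurable.mul ?_ (Lp.memLp f).1
    exact (Complex.continuous_ofReal.comp
      ((η.continuous_symbol k).comp (continuous_const_smul _))).aestronglyMeasurable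
  · refine Filter.Eventually.of_forall fun w => ?_
    rw [norm_mul, Complex.norm_real, Real.norm_eq_abs]
    exact mul_le_of_le_one_left (norm_nonneg _) (η.abs_symbol_le k _)

/-- The Littlewood–Paley projection `P_k f = 𝓕⁻¹ (m_k 𝓕 f)` on `L²(ℝ³)`, where `m_k` is the symbol
above in the frequency variable `ξ` of the convention `∫ e^{-i x·ξ} f(x) dx`. The transform `𝓕` of
the library is `∫ e^{-2πi x·w} f(x) dx`, that is, `ξ = 2π w`. -/
def proj (η : LPCutoff) (k : ℕ) (f : Lp (α := E3) ℂ 2) : Lp (α := E3) ℂ 2 :=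
  𝓕⁻ (η.memLp_symbol_mul k (𝓕 f)).toLp

/-- The norm `‖f‖_{H^s(ℝ³)} = (∑_{k ≥ 0} 2^{2sk} ‖P_k f‖²_{L²})^{1/2}`, with the value `∞` for those
`f ∈ L²` that do not belong to `H^s`. -/
def hsNorm (η : LPCutoff) (s : ℝ) (f : Lp (α := E3) ℂ 2) : ℝ≥0∞ :=
  (∑' k : ℕ, (2 : ℝ≥0∞) ^ (2 * s * (k : ℝ)) * ‖η.proj k f‖ₑ ^ 2) ^ (1 / 2 : ℝ)

/-- The norm `‖f‖_{H^s(Ω)}` of a real function on `Ω`: the infimum of the `H^s(ℝ³)`-norms of its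
real-valued extensions to `ℝ³` (`∞` when there is no extension in `H^s`). Only the values of `f`
on `Ω` matter. -/
def hsNormOn (η : LPCutoff) (s : ℝ) (Ω : Set E3) (f : E3 → ℝ) : ℝ≥0∞ :=
  ⨅ (u : E3 → ℝ) (hu : MemLp (fun x => (u x : ℂ)) 2 (volume : Measure E3))
    (_ : ∀ x ∈ Ω, u x = f x), η.hsNorm s hu.toLp

/-- The norm `‖T‖_{H^s(Ω)}` of a covariant `2`-tensor field: the sum of the norms of its Cartesian
components. -/
def tensorHsNormOn (η : LPCutoff) (s : ℝ) (Ω : Set E3) (T : Tensor2) : ℝ≥0∞ :=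
  ∑ i : Fin 3, ∑ j : Fin 3, η.hsNormOn s Ω (fun x => T x i j)

end LPCutoff

/-! ### Riemannian geometry in Cartesian coordinates -/

/-- The partial derivative `∂_i f` at `x`. -/
def pd (i : Fin 3) (f : E3 → ℝ) (x : E3) : ℝ :=
  fderiv ℝ f x (EuclideanSpace.single i (1 : ℝ))

/-- The value `T_x(X, Y) = T_{ij} X^i Y^j`. -/
def ev (T : Tensor2) (x : E3) (X Y : E3) : ℝ :=
  ∑ i, ∑ j, T x i j * X i * Y j

/-- The components `g^{ij}` of the inverse metric. -/
def ginv (g : Tensor2) (x : E3) (i j : Fin 3) : ℝ := (g x)⁻¹ i j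

/-- The Christoffel symbols `Γ^m_{ij}` of the Levi-Civita connection. -/
def christoffel (g : Tensor2) (m i j : Fin 3) (x : E3) : ℝ :=
  (1 / 2) * ∑ l, ginv g x m l *
    (pd i (fun y => g y j l) x + pd j (fun y => g y i l) x - pd l (fun y => g y i j) x)

/-- The Ricci tensor
`R_{ij} = ∂_m Γ^m_{ij} - ∂_j Γ^m_{im} + Γ^m_{ml} Γ^l_{ij} - Γ^m_{jl} Γ^l_{im}`. -/
def ricci (g : Tensor2) (i j : Fin 3) (x : E3) : ℝ :=
  (∑ m, (pd m (christoffel g m i j) x - pd j (christoffel g m i m) x)) +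
    ∑ m, ∑ l, (christoffel g m m l x * christoffel g l i j x -
      christoffel g m j l x * christoffel g l i m x)

/-- The scalar curvature `R[g] = g^{ij} R_{ij}`. -/
def scalarCurvature (g : Tensor2) (x : E3) : ℝ :=
  ∑ i, ∑ j, ginv g x i j * ricci g i j x

/-- The trace `tr_g k = g^{ij} k_{ij}`. -/
def trace (g k : Tensor2) (x : E3) : ℝ :=
  ∑ i, ∑ j, ginv g x i j * k x i j

/-- `‖k‖_g² = g^{ia} g^{jb} k_{ij} k_{ab}`. -/
def normSqTensor (g k : Tensor2) (x : E3) : ℝ :=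
  ∑ i, ∑ j, ∑ a, ∑ b, ginv g x i a * ginv g x j b * k x i j * k x a b

/-- `‖∇ψ‖_g² = g^{ij} ∂_i ψ ∂_j ψ`. -/
def normSqGrad (g : Tensor2) (ψ : E3 → ℝ) (x : E3) : ℝ :=
  ∑ i, ∑ j, ginv g x i j * pd i ψ x * pd j ψ x

/-- The covariant derivative `∇_a k_{ij} = ∂_a k_{ij} - Γ^m_{ai} k_{mj} - Γ^m_{aj} k_{im}`. -/
def covDeriv (g k : Tensor2) (a i j : Fin 3) (x : E3) : ℝ :=
  pd a (fun y => k y i j) x - ∑ m, christoffel g m a i x * k x m j -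
    ∑ m, christoffel g m a j x * k x i m

/-- The divergence `(div_g k)_j = g^{ai} ∇_a k_{ij}`. -/
def divergence (g k : Tensor2) (j : Fin 3) (x : E3) : ℝ :=
  ∑ a, ∑ i, ginv g x a i * covDeriv g k a i j x

/-- The covariant derivative `∇_X N` of a vector field `N`, for `X ∈ T_x ℝ³`:
`(∇_X N)^m = X^a ∂_a N^m + Γ^m_{ab} X^a N^b`. -/
def covDerivVec (g : Tensor2) (N : E3 → E3) (x X : E3) : E3 :=
  WithLp.toLp 2 fun m =>
    (∑ a, X a * pd a (fun y => N y m) x) + ∑ a, ∑ b, christoffel g m a b x * X a * N x b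

/-! ### Initial data for the Einstein–scalar field system -/

/-- `(g, k; ψ₀, ψ₁)` is a smooth initial data set for the Einstein–scalar field system on the open
set `Ω ⊆ ℝ³`: `g` is a Riemannian metric, `k` a symmetric covariant `2`-tensor, `ψ₀, ψ₁` are
functions, and the Hamiltonian and momentum constraints hold on `Ω`. -/
structure IsInitialData (Ω : Set E3) (g k : Tensor2) (ψ₀ ψ₁ : E3 → ℝ) : Prop where
  smooth_metric : ∀ i j, ContDiffOn ℝ ∞ (fun x => g x i j) Ω
  smooth_k : ∀ i j, ContDiffOn ℝ ∞ (fun x => k x i j) Ω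
  smooth_psi0 : ContDiffOn ℝ ∞ ψ₀ Ω
  smooth_psi1 : ContDiffOn ℝ ∞ ψ₁ Ω
  posDef_metric : ∀ x ∈ Ω, (g x).PosDef
  symm_k : ∀ x ∈ Ω, (k x).IsSymm
  hamiltonian : ∀ x ∈ Ω,
    scalarCurvature g x + trace g k x ^ 2 - normSqTensor g k x = normSqGrad g ψ₀ x + ψ₁ x ^ 2
  momentum : ∀ x ∈ Ω, ∀ j : Fin 3,
    divergence g k j x - pd j (trace g k) x = ψ₁ x * pd j ψ₀ x

/-- The action of a matrix on `ℝ³`. -/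
def act (A : Matrix (Fin 3) (Fin 3) ℝ) (x : E3) : E3 := WithLp.toLp 2 (A.mulVec x.ofLp)

/-- Spherical symmetry on the unit ball: the tensors `g, k` and the functions `ψ₀, ψ₁` are invariant
under pullback by every orthogonal transformation of `ℝ³`. -/
structure IsSphericallySymmetric (g k : Tensor2) (ψ₀ ψ₁ : E3 → ℝ) : Prop where
  metric : ∀ A ∈ Matrix.orthogonalGroup (Fin 3) ℝ, ∀ x ∈ unitBall,
    A.transpose * g (act A x) * A = g x
  k : ∀ A ∈ Matrix.orthogonalGroup (Fin 3) ℝ, ∀ x ∈ unitBall,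
    A.transpose * k (act A x) * A = k x
  psi0 : ∀ A ∈ Matrix.orthogonalGroup (Fin 3) ℝ, ∀ x ∈ unitBall, ψ₀ (act A x) = ψ₀ x
  psi1 : ∀ A ∈ Matrix.orthogonalGroup (Fin 3) ℝ, ∀ x ∈ unitBall, ψ₁ (act A x) = ψ₁ x

/-! ### Embedded trapped spheres -/

/-- The standard two-sphere. -/
abbrev S2 : Type := Metric.sphere (0 : E3) 1

/-- `Φ : S² → ℝ³` is a smooth embedding: a smooth injective immersion (the source is compact, so
`Φ` is then a homeomorphism onto its image). -/
structure IsEmbeddedSphere (Φ : S2 → E3) : Prop where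
  smooth : ContMDiff (𝓡 2) 𝓘(ℝ, E3) ∞ Φ
  injective : Function.Injective Φ
  immersion : ∀ p : S2, Function.Injective (mfderiv (𝓡 2) 𝓘(ℝ, E3) Φ p)

/-- `X` is tangent to the surface `Φ(S²)` at the point `Φ p`. -/
def IsTangent (Φ : S2 → E3) (p : S2) (X : E3) : Prop :=
  ∃ v : TangentSpace (𝓡 2) p, mfderiv (𝓡 2) 𝓘(ℝ, E3) Φ p v = X

/-- `N` is a vector field, defined and smooth on a neighbourhood of the surface `Φ(S²)`, whose
restriction to the surface is a unit normal field with respect to `g`. -/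
structure IsUnitNormal (g : Tensor2) (Φ : S2 → E3) (N : E3 → E3) : Prop where
  smooth : ∃ U : Set E3, IsOpen U ∧ Set.range Φ ⊆ U ∧ ContDiffOn ℝ ∞ N U
  normal : ∀ (p : S2) (X : E3), IsTangent Φ p X → ev g (Φ p) (N (Φ p)) X = 0
  unit : ∀ p : S2, ev g (Φ p) (N (Φ p)) (N (Φ p)) = 1

/-- The second fundamental form `h(X, Y) = ⟨∇_X N, Y⟩_g` at the point `x` of the surface, for
`X, Y` tangent to it. On such vectors it depends only on the restriction of `N` to the surface. -/
def secondFF (g : Tensor2) (N : E3 → E3) (x X Y : E3) : ℝ :=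
  ev g x (covDerivVec g N x X) Y

/-- `X, Y` is an orthonormal basis of the tangent plane of the surface `Φ(S²)` at `Φ p`, for the
metric induced by `g`. -/
structure IsOrthonormalFrame (g : Tensor2) (Φ : S2 → E3) (p : S2) (X Y : E3) : Prop where
  tangent_left : IsTangent Φ p X
  tangent_right : IsTangent Φ p Y
  unit_left : ev g (Φ p) X X = 1
  unit_right : ev g (Φ p) Y Y = 1
  orthogonal : ev g (Φ p) X Y = 0

/-- `Φ` is a smooth embedded trapped sphere in `(Ω, g, k)`: at every point of the surface the traces
of `k + h` and of `k - h` with respect to the induced metric are negative. The trace is the sum of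
the diagonal values in any orthonormal basis of the tangent plane; the condition does not depend on
which of the two unit normals is used, since `h` changes sign with the normal. -/
structure IsTrappedSphere (Ω : Set E3) (g k : Tensor2) (Φ : S2 → E3) : Prop where
  embedded : IsEmbeddedSphere Φ
  subset : Set.range Φ ⊆ Ω
  trapped : ∃ N : E3 → E3, IsUnitNormal g Φ N ∧
    ∀ (p : S2) (X Y : E3), IsOrthonormalFrame g Φ p X Y →
      (ev k (Φ p) X X + secondFF g N (Φ p) X X) + (ev k (Φ p) Y Y + secondFF g N (Φ p) Y Y) < 0 ∧
      (ev k (Φ p) X X - secondFF g N (Φ p) X X) + (ev k (Φ p) Y Y - secondFF g N (Φ p) Y Y) < 0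

end EinsteinScalar

end

open EinsteinScalar

/-!
The data are conformally flat and umbilic: `g = Φ(|x|²) e`, `k = -β g` with a constant `β > 0`,
`ψ₀ = 0`. The metric being parallel, the momentum constraint holds trivially, and the Hamiltonian
constraint reads `ψ₁² = R[g] + 6 β²`. It is solved by a smooth `ψ₁` as soon as `R[g] ≥ 0`, which
holds if `Φ' ≤ 0` and `Φ'' ≤ 0` on `[0, 1)` (`radialCurvature_nonneg`). The sphere `|x|² = s₀` has
area `4π s₀ Φ(s₀)`; where this is stationary the sphere is totally geodesic, and both null
expansions are equal to `tr k = -2β < 0` (`isTrappedSphere_confMetric`). So it remains to find a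
concave decreasing `Φ` with `Φ - 1` small in `H^{3/2}` and `(s Φ)' = 0` somewhere in `(0, 1)`, and
then to take `β` small.

Such a `Φ` exists because the `H^{3/2}` norm does not control the slope on a sphere. Take a bump
profile `V` which is concave and decreasing on `(-∞, 0]` with `V'(0) = -2`, and put `Φ = 1 + N⁻¹
∑_{k < N} v_k` with `v_k(s) = 2^{-(k+1)} V(2^{k+1} (s - 1))`. All the `v_k` have slope `-2` at `s
= 1`, hence `(s Φ)'(1) ≤ 1 - 2 < 0 < (s Φ)'(0)`, and there is a zero in between
(`IsProfile.exists_minimal`). Each `v_k(|x|²)` has `H^{3/2}` norm of order one, but these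
functions are almost orthogonal, so that their average has norm of order `N^{-1/2}`
(`IsProfile.exists_hsNorm_averagedProfile_le`). The almost orthogonality is a Cauchy–Schwarz
inequality on the Fourier side, with the weights `2^{-k} |ξ|⁴ + 2^{3k}` (`cube_mul_sq_sum_le`),
which reduces everything to the bounds `‖v_k‖² ≲ 2^{-3k}` and `‖Δ v_k‖² ≲ 2^k` in `L²`
(`LPCutoff.hsNorm_sum_sq_le`); these come from the thickness `2^{-k}` of the supporting shell.
-/

namespace EinsteinScalar

open scoped SchwartzMap

/-! ### Summation over dyadic scales -/

theorem eight_pow_eq (k : ℕ) : (8 : ℝ) ^ k = (2 ^ k) ^ 3 := by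
  rw [← pow_mul, mul_comm, pow_mul]; norm_num

/-- The difference on the right, of values of the bounded function `6 y / (1 + y)`, telescopes under
`y ↦ y / 2`, which bounds the sum of the left-hand side over dyadic scales. -/
theorem dyadicWeight_le_telescope {y : ℝ} (hy : 0 ≤ y) :
    y ^ 3 / (1 + y ^ 4) ≤ 6 * y / (1 + y) - 6 * (y / 2) / (1 + y / 2) := by
  have h : 6 * y / (1 + y) - 6 * (y / 2) / (1 + y / 2) = 6 * y / ((1 + y) * (2 + y)) := by
    have : 1 + y ≠ 0 := by positivity
    have : 2 + y ≠ 0 := by positivity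
    have : 1 + y / 2 ≠ 0 := by positivity
    field_simp
    ring
  rw [h, div_le_div_iff₀ (by positivity) (by positivity)]
  have key : y ^ 2 * ((1 + y) * (2 + y)) ≤ 6 * (1 + y ^ 4) := by
    nlinarith [sq_nonneg (y ^ 2 - y), sq_nonneg (y ^ 2 - 1), sq_nonneg (y - 1), sq_nonneg y]
  nlinarith [mul_le_mul_of_nonneg_left key hy]

theorem sum_dyadicWeight_le {y : ℝ} (hy : 0 ≤ y) (N : ℕ) :
    ∑ k ∈ Finset.range N, (y / 2 ^ k) ^ 3 / (1 + (y / 2 ^ k) ^ 4) ≤ 6 := by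
  have h : ∀ k ∈ Finset.range N, (y / 2 ^ k) ^ 3 / (1 + (y / 2 ^ k) ^ 4) ≤
      (fun k : ℕ => 6 * (y / 2 ^ k) / (1 + y / 2 ^ k)) k -
        (fun k : ℕ => 6 * (y / 2 ^ k) / (1 + y / 2 ^ k)) (k + 1) := fun k _ => by
    have := dyadicWeight_le_telescope (y := y / 2 ^ k) (by positivity)
    simpa only [pow_succ, div_div] using this
  refine (Finset.sum_le_sum h).trans ?_
  rw [Finset.sum_range_sub']
  have h0 : 0 ≤ 6 * (y / 2 ^ N) / (1 + y / 2 ^ N) := by positivity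
  have h1 : 6 * (y / 2 ^ 0) / (1 + y / 2 ^ 0) ≤ 6 := by
    rw [div_le_iff₀ (by positivity)]
    simp only [pow_zero, div_one]
    linarith
  linarith

/-- Cauchy–Schwarz with the weights `2^{-k} r⁴ + 2^{3k}`: since `r³ / (2^{-k} r⁴ + 2^{3k})` has a sum
over `k` bounded independently of `r` and `N`, functions living at different dyadic frequencies
are almost orthogonal for the weight `r³`. -/
theorem cube_mul_sq_sum_le {r : ℝ} (hr : 0 ≤ r) (N : ℕ) (a : ℕ → ℝ) :
    (1 + 600 * r ^ 3) * (∑ k ∈ Finset.range N, a k) ^ 2 ≤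
      3602 * ∑ k ∈ Finset.range N, (r ^ 4 / 2 ^ k + 8 ^ k) * a k ^ 2 := by
  have hpos : ∀ k : ℕ, 0 < r ^ 4 / 2 ^ k + 8 ^ k := fun k => by positivity
  have hcs : (∑ k ∈ Finset.range N, a k) ^ 2 ≤
      (∑ k ∈ Finset.range N, (r ^ 4 / 2 ^ k + 8 ^ k)⁻¹) *
        ∑ k ∈ Finset.range N, (r ^ 4 / 2 ^ k + 8 ^ k) * a k ^ 2 := by
    refine Finset.sum_sq_le_sum_mul_sum_of_sq_le_mul _ (fun k _ => (inv_pos.2 (hpos k)).le)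
      (fun k _ => mul_nonneg (hpos k).le (sq_nonneg _)) (fun k _ => ?_)
    rw [inv_mul_cancel_left₀ (hpos k).ne']
  have h1 : ∑ k ∈ Finset.range N, (r ^ 4 / 2 ^ k + 8 ^ k)⁻¹ ≤ 2 := by
    have : ∀ k ∈ Finset.range N, (r ^ 4 / 2 ^ k + 8 ^ k)⁻¹ ≤ (1 / 2 : ℝ) ^ k := fun k _ => by
      rw [one_div, inv_pow]
      apply inv_anti₀ (by positivity)
      have h8 : (2 : ℝ) ^ k ≤ 8 ^ k := pow_le_pow_left₀ (by norm_num) (by norm_num) k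
      have : 0 ≤ r ^ 4 / 2 ^ k := by positivity
      linarith
    refine (Finset.sum_le_sum this).trans ?_
    exact sum_geometric_two_le N
  have h2 : r ^ 3 * ∑ k ∈ Finset.range N, (r ^ 4 / 2 ^ k + 8 ^ k)⁻¹ ≤ 6 := by
    rw [Finset.mul_sum]
    refine le_trans (le_of_eq (Finset.sum_congr rfl fun k _ => ?_)) (sum_dyadicWeight_le hr N)
    have e8 := eight_pow_eq k
    have : (0 : ℝ) < 2 ^ k := by positivity
    rw [e8]
    generalize (2 : ℝ) ^ k = p at this
    have h3 : r ^ 4 / p + p ^ 3 ≠ 0 := by positivity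
    have h4 : 1 + (r / p) ^ 4 ≠ 0 := by positivity
    field_simp
    ring
  have hS : 0 ≤ ∑ k ∈ Finset.range N, (r ^ 4 / 2 ^ k + 8 ^ k) * a k ^ 2 :=
    Finset.sum_nonneg fun k _ => mul_nonneg (hpos k).le (sq_nonneg _)
  calc _ ≤ (1 + 600 * r ^ 3) * ((∑ k ∈ Finset.range N, (r ^ 4 / 2 ^ k + 8 ^ k)⁻¹) *
        ∑ k ∈ Finset.range N, (r ^ 4 / 2 ^ k + 8 ^ k) * a k ^ 2) :=
        mul_le_mul_of_nonneg_left hcs (by positivity)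
    _ = ((∑ k ∈ Finset.range N, (r ^ 4 / 2 ^ k + 8 ^ k)⁻¹) +
        600 * (r ^ 3 * ∑ k ∈ Finset.range N, (r ^ 4 / 2 ^ k + 8 ^ k)⁻¹)) *
        ∑ k ∈ Finset.range N, (r ^ 4 / 2 ^ k + 8 ^ k) * a k ^ 2 := by ring
    _ ≤ _ := mul_le_mul_of_nonneg_right (by linarith) hS

/-! ### The Littlewood–Paley norm on the Fourier side -/

namespace LPCutoff

/-- The symbol `m_{k+1}` is supported in `2^k ≤ |ξ| ≤ 2^{k+2}`, where the weight on the right is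
bounded below. -/
theorem symbol_succ_sq_le (η : LPCutoff) (k : ℕ) (ξ : E3) :
    8 ^ (k + 1) * η.symbol (k + 1) ξ ^ 2 ≤
      100 * ‖ξ‖ ^ 3 * ((‖ξ‖ / 2 ^ k) ^ 3 / (1 + (‖ξ‖ / 2 ^ k) ^ 4)) := by
  have hp : (0 : ℝ) < 2 ^ k := by positivity
  have hn : ∀ m : ℕ, ‖(((2 : ℝ) ^ m)⁻¹ • ξ)‖ = ‖ξ‖ / 2 ^ m := fun m => by
    rw [norm_smul, norm_inv, norm_pow, Real.norm_ofNat, inv_mul_eq_div]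
  have hrhs : 0 ≤ 100 * ‖ξ‖ ^ 3 * ((‖ξ‖ / 2 ^ k) ^ 3 / (1 + (‖ξ‖ / 2 ^ k) ^ 4)) := by
    positivity
  have hsucc : ‖ξ‖ / 2 ^ (k + 1) = ‖ξ‖ / 2 ^ k / 2 := by rw [pow_succ, div_div]
  rcases le_or_gt (‖ξ‖ / 2 ^ k) 1 with h | h
  · have h0 : η.symbol (k + 1) ξ = 0 := by
      simp only [symbol]
      rw [η.eq_one _ (by rw [hn, hsucc]; linarith), η.eq_one _ (by rw [hn]; exact h), sub_self]
    rw [h0]; simpa using hrhs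
  rcases le_or_gt 4 (‖ξ‖ / 2 ^ k) with h' | h'
  · have h0 : η.symbol (k + 1) ξ = 0 := by
      simp only [symbol]
      rw [η.eq_zero _ (by rw [hn, hsucc]; linarith), η.eq_zero _ (by rw [hn]; linarith), sub_self]
    rw [h0]; simpa using hrhs
  have hm : η.symbol (k + 1) ξ ^ 2 ≤ 1 := by
    rw [← sq_abs]; exact pow_le_one₀ (abs_nonneg _) (η.abs_symbol_le _ _)
  set y := ‖ξ‖ / 2 ^ k with hy
  have hxi : ‖ξ‖ = y * 2 ^ k := by rw [hy]; field_simp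
  have e8 := eight_pow_eq k
  have h3 : (8 : ℝ) ≤ 100 * y ^ 3 * (y ^ 3 / (1 + y ^ 4)) := by
    rw [mul_div_assoc', le_div_iff₀ (by positivity)]
    nlinarith [pow_le_pow_left₀ zero_le_one h.le 4, mul_nonneg (pow_nonneg (zero_le_one.trans h.le) 4)
      (by nlinarith : 0 ≤ y ^ 2 - 1)]
  calc 8 ^ (k + 1) * η.symbol (k + 1) ξ ^ 2 ≤ 8 ^ (k + 1) * 1 :=
        mul_le_mul_of_nonneg_left hm (by positivity)
    _ = 8 * (2 ^ k) ^ 3 := by rw [pow_succ, e8]; ring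
    _ ≤ (100 * y ^ 3 * (y ^ 3 / (1 + y ^ 4))) * (2 ^ k) ^ 3 :=
        mul_le_mul_of_nonneg_right h3 (by positivity)
    _ = _ := by rw [hxi]; ring

theorem sum_symbol_sq_le (η : LPCutoff) (n : ℕ) (ξ : E3) :
    ∑ k ∈ Finset.range n, 8 ^ k * η.symbol k ξ ^ 2 ≤ 1 + 600 * ‖ξ‖ ^ 3 := by
  cases n with
  | zero => simp; positivity
  | succ n =>
    rw [Finset.sum_range_succ']
    have h0 : η.symbol 0 ξ ^ 2 ≤ 1 := by
      rw [← sq_abs]; exact pow_le_one₀ (abs_nonneg _) (η.abs_symbol_le _ _)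
    have h1 := Finset.sum_le_sum fun k (_ : k ∈ Finset.range n) => η.symbol_succ_sq_le k ξ
    rw [← Finset.mul_sum] at h1
    have h2 := mul_le_mul_of_nonneg_left (sum_dyadicWeight_le (norm_nonneg ξ) n)
      (by positivity : 0 ≤ 100 * ‖ξ‖ ^ 3)
    simp only [pow_zero, one_mul]
    linarith

theorem tsum_symbol_sq_le (η : LPCutoff) {s : ℝ} (hs : s ≤ 3 / 2) (ξ : E3) :
    ∑' k : ℕ, (2 : ℝ≥0∞) ^ (2 * s * (k : ℝ)) * ‖((η.symbol k ξ : ℝ) : ℂ)‖ₑ ^ 2 ≤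
      ENNReal.ofReal (1 + 600 * ‖ξ‖ ^ 3) := by
  refine ENNReal.tsum_le_of_sum_range_le fun n => ?_
  refine le_trans (Finset.sum_le_sum fun k _ => ?_)
    ((ENNReal.ofReal_sum_of_nonneg (s := Finset.range n)
      (f := fun k => 8 ^ k * η.symbol k ξ ^ 2) fun k _ => by positivity).symm.le.trans
        (ENNReal.ofReal_le_ofReal (η.sum_symbol_sq_le n ξ)))
  rw [ENNReal.ofReal_mul (by positivity)]
  refine mul_le_mul' ?_ (le_of_eq ?_)
  · calc (2 : ℝ≥0∞) ^ (2 * s * (k : ℝ)) ≤ (2 : ℝ≥0∞) ^ ((3 * k : ℕ) : ℝ) := by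
          refine ENNReal.rpow_le_rpow_of_exponent_le (by norm_num) ?_
          push_cast
          have : (0 : ℝ) ≤ k := k.cast_nonneg
          nlinarith
      _ = ENNReal.ofReal (8 ^ k) := by
          rw [ENNReal.rpow_natCast, pow_mul, ENNReal.ofReal_pow (by norm_num)]
          norm_num
  · rw [← ofReal_norm, ← ENNReal.ofReal_pow (norm_nonneg _), Complex.norm_real,
      Real.norm_eq_abs, sq_abs]

theorem enorm_toLp_sq {f : E3 → ℂ} (hf : MemLp f 2 (volume : Measure E3)) :
    ‖hf.toLp f‖ₑ ^ 2 = ∫⁻ x, ‖f x‖ₑ ^ 2 := by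
  rw [Lp.enorm_toLp]
  have := eLpNorm_nnreal_pow_eq_lintegral (f := f) (μ := (volume : Measure E3)) (p := 2)
    (by norm_num)
  norm_num at this
  exact_mod_cast this

theorem enorm_proj_sq (η : LPCutoff) (k : ℕ) (f : Lp (α := E3) ℂ 2) :
    ‖η.proj k f‖ₑ ^ 2 =
      ∫⁻ w, ‖((η.symbol k ((2 * Real.pi) • w) : ℝ) : ℂ)‖ₑ ^ 2 *
        ‖(𝓕 f : Lp ℂ 2 (volume : Measure E3)) w‖ₑ ^ 2 := by
  have h : ‖η.proj k f‖ₑ = ‖(η.memLp_symbol_mul k (𝓕 f)).toLp‖ₑ := by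
    rw [← ofReal_norm, ← ofReal_norm]
    exact congrArg ENNReal.ofReal ((Lp.fourierTransformₗᵢ E3 ℂ).symm.norm_map _)
  rw [h, enorm_toLp_sq]
  refine lintegral_congr fun w => ?_
  rw [enorm_mul, mul_pow]

/-- The Littlewood–Paley norm is controlled by a weighted `L²` norm on the Fourier side. In the
library's convention the frequency variable is `ξ = 2π w`. -/
theorem hsNorm_sq_le (η : LPCutoff) {s : ℝ} (hs : s ≤ 3 / 2) (f : Lp (α := E3) ℂ 2) :
    η.hsNorm s f ^ 2 ≤
      ∫⁻ w, ENNReal.ofReal (1 + 600 * ‖(2 * Real.pi) • w‖ ^ 3) *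
        ‖(𝓕 f : Lp ℂ 2 (volume : Measure E3)) w‖ₑ ^ 2 := by
  have h1 : η.hsNorm s f ^ 2 = ∑' k : ℕ, (2 : ℝ≥0∞) ^ (2 * s * (k : ℝ)) * ‖η.proj k f‖ₑ ^ 2 := by
    rw [hsNorm, ← ENNReal.rpow_natCast, ← ENNReal.rpow_mul]
    norm_num
  have hm : ∀ k : ℕ, Measurable fun w : E3 =>
      ‖((η.symbol k ((2 * Real.pi) • w) : ℝ) : ℂ)‖ₑ ^ 2 := fun k =>
    ((Complex.continuous_ofReal.comp
      ((η.continuous_symbol k).comp (continuous_const_smul _))).measurable.enorm).pow_const 2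
  have hf : AEMeasurable (fun w : E3 => ‖(𝓕 f : Lp ℂ 2 (volume : Measure E3)) w‖ₑ ^ 2) volume :=
    (Lp.aestronglyMeasurable (𝓕 f)).aemeasurable.enorm.pow_const 2
  have hmf : ∀ k : ℕ, AEMeasurable (fun w : E3 =>
      ‖((η.symbol k ((2 * Real.pi) • w) : ℝ) : ℂ)‖ₑ ^ 2 *
        ‖(𝓕 f : Lp ℂ 2 (volume : Measure E3)) w‖ₑ ^ 2) volume := fun k => (hm k).aemeasurable.mul hf
  have h2 : ∀ k : ℕ, (2 : ℝ≥0∞) ^ (2 * s * (k : ℝ)) * ‖η.proj k f‖ₑ ^ 2 =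
      ∫⁻ w, (2 : ℝ≥0∞) ^ (2 * s * (k : ℝ)) *
        (‖((η.symbol k ((2 * Real.pi) • w) : ℝ) : ℂ)‖ₑ ^ 2 *
          ‖(𝓕 f : Lp ℂ 2 (volume : Measure E3)) w‖ₑ ^ 2) := fun k => by
    rw [enorm_proj_sq, lintegral_const_mul'' _ (hmf k)]
  rw [h1]
  simp only [h2]
  rw [← lintegral_tsum fun k => (hmf k).const_mul _]
  refine lintegral_mono fun w => ?_
  simp only [← mul_assoc]
  rw [ENNReal.tsum_mul_right]
  exact mul_le_mul_left (η.tsum_symbol_sq_le hs _) _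

end LPCutoff

/-! ### Plancherel for the Laplacian -/

theorem lintegral_enorm_fourier_sq (u : 𝓢(E3, ℂ)) :
    ∫⁻ w, ‖𝓕 u w‖ₑ ^ 2 = ∫⁻ x, ‖u x‖ₑ ^ 2 := by
  have h := SchwartzMap.norm_fourier_toL2_eq u
  rw [← LPCutoff.enorm_toLp_sq ((𝓕 u).memLp 2 volume), ← LPCutoff.enorm_toLp_sq (u.memLp 2 volume),
    ← ofReal_norm, ← ofReal_norm]
  exact congrArg (fun r : ℝ => ENNReal.ofReal r ^ 2) h

open Laplacian in
theorem fourier_laplacian_apply (u : 𝓢(E3, ℂ)) (w : E3) :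
    𝓕 (Δ u) w = -((‖(2 * Real.pi) • w‖ ^ 2 : ℝ) : ℂ) * 𝓕 u w := by
  rw [SchwartzMap.laplacian_eq_fourierMultiplierCLM, FourierTransform.fourier_smul,
    SchwartzMap.fourierMultiplierCLM_apply, FourierTransform.fourier_fourierInv_eq,
    smul_apply, SchwartzMap.smulLeftCLM_apply_apply (by fun_prop)]
  rw [norm_smul, Real.norm_of_nonneg (by positivity)]
  simp only [Complex.real_smul]
  push_cast
  ring

open Laplacian in
theorem lintegral_fourth_mul_enorm_fourier_sq (u : 𝓢(E3, ℂ)) :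
    ∫⁻ w, ENNReal.ofReal (‖(2 * Real.pi) • w‖ ^ 4) * ‖𝓕 u w‖ₑ ^ 2 =
      ∫⁻ x, ‖Δ u x‖ₑ ^ 2 := by
  rw [← lintegral_enorm_fourier_sq]
  refine lintegral_congr fun w => ?_
  rw [fourier_laplacian_apply, enorm_mul, mul_pow, enorm_neg]
  congr 1
  rw [← ofReal_norm, ← ENNReal.ofReal_pow (norm_nonneg _), Complex.norm_real,
    Real.norm_eq_abs, sq_abs, ← pow_mul]

theorem enorm_ofReal (r : ℝ) : ‖(r : ℂ)‖ₑ = ‖r‖ₑ := by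
  rw [← ofReal_norm, ← ofReal_norm, Complex.norm_real]

/-- The flat Laplacian in Cartesian coordinates. -/
noncomputable def lap (v : E3 → ℝ) (x : E3) : ℝ := ∑ i, pd i (pd i v) x

theorem fderiv_ofReal_comp {v : E3 → ℝ} (hv : Differentiable ℝ v) (x e : E3) :
    fderiv ℝ (fun x => (v x : ℂ)) x e = (fderiv ℝ v x e : ℂ) := by
  have := (Complex.ofRealCLM.hasFDerivAt.comp x (hv x).hasFDerivAt).fderiv
  exact congrArg (fun L : E3 →L[ℝ] ℂ => L e) this

theorem contDiff_pd {v : E3 → ℝ} (hv : ContDiff ℝ ∞ v) (i : Fin 3) : ContDiff ℝ ∞ (pd i v) :=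
  (hv.fderiv_right (m := ∞) le_rfl).clm_apply contDiff_const

open Laplacian in
theorem laplacian_ofReal_apply {v : E3 → ℝ} (hv : ContDiff ℝ ∞ v) (u : 𝓢(E3, ℂ))
    (hu : ∀ x, u x = v x) (x : E3) : Δ u x = (lap v x : ℂ) := by
  rw [SchwartzMap.laplacian_eq_sum (EuclideanSpace.basisFun (Fin 3) ℝ), sum_apply, lap]
  push_cast
  refine Finset.sum_congr rfl fun i _ => ?_
  have h1 : ∀ y, LineDeriv.lineDerivOp (EuclideanSpace.basisFun (Fin 3) ℝ i) u y =
      ((pd i v y : ℝ) : ℂ) := fun y => by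
    rw [SchwartzMap.lineDerivOp_apply_eq_fderiv, show (u : E3 → ℂ) = fun x => (v x : ℂ) from
      funext hu, fderiv_ofReal_comp (hv.differentiable (by simp)), EuclideanSpace.basisFun_apply]
    rfl
  rw [SchwartzMap.lineDerivOp_apply_eq_fderiv, show
    ((LineDeriv.lineDerivOp (EuclideanSpace.basisFun (Fin 3) ℝ i) u : 𝓢(E3, ℂ)) : E3 → ℂ) =
    fun x => ((pd i v x : ℝ) : ℂ) from funext h1,
    fderiv_ofReal_comp ((contDiff_pd hv i).differentiable (by simp)), EuclideanSpace.basisFun_apply]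
  rfl

/-- A smooth compactly supported real function as a complex Schwartz function. -/
noncomputable def toSchwartz {v : E3 → ℝ} (hv : ContDiff ℝ ∞ v) (hc : HasCompactSupport v) :
    𝓢(E3, ℂ) :=
  (show HasCompactSupport (fun x => (v x : ℂ)) from
    hc.comp_left (g := ((↑) : ℝ → ℂ)) Complex.ofReal_zero).toSchwartzMap
    (Complex.ofRealCLM.contDiff.comp hv)

theorem toSchwartz_apply {v : E3 → ℝ} (hv : ContDiff ℝ ∞ v) (hc : HasCompactSupport v) (x : E3) :
    toSchwartz hv hc x = v x := rfl

/-- The `H^s` norm, `s ≤ 3/2`, of a superposition of functions `v k` is controlled by their `L²` norms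
and those of their Laplacians, with weights adapted to `v k` having frequencies about `2^k`.
There is no loss from interactions between different `k`. -/
theorem LPCutoff.hsNorm_sum_sq_le (η : LPCutoff) {s : ℝ} (hs : s ≤ 3 / 2) (N : ℕ) (c : ℝ)
    (v : ℕ → E3 → ℝ) (hv : ∀ k, ContDiff ℝ ∞ (v k)) (hc : ∀ k, HasCompactSupport (v k))
    (hu : MemLp (fun x => ((c * ∑ k ∈ Finset.range N, v k x : ℝ) : ℂ)) 2 (volume : Measure E3)) :
    η.hsNorm s hu.toLp ^ 2 ≤ ENNReal.ofReal (3602 * c ^ 2) * ∑ k ∈ Finset.range N,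
      (ENNReal.ofReal ((2 ^ k)⁻¹) * (∫⁻ x, ‖lap (v k) x‖ₑ ^ 2) +
        ENNReal.ofReal (8 ^ k) * ∫⁻ x, ‖v k x‖ₑ ^ 2) := by
  set V : ℕ → 𝓢(E3, ℂ) := fun k => toSchwartz (hv k) (hc k) with hV
  set u : 𝓢(E3, ℂ) := (c : ℂ) • ∑ k ∈ Finset.range N, V k with hudef
  have hu' : hu.toLp = u.toLp 2 volume := by
    refine (MemLp.toLp_eq_toLp_iff hu (u.memLp 2 volume)).2 (Filter.Eventually.of_forall fun x => ?_)
    simp [hudef, hV, toSchwartz_apply]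
  have hF : ∀ w, 𝓕 u w = (c : ℂ) * ∑ k ∈ Finset.range N, 𝓕 (V k) w := fun w => by
    rw [hudef, FourierTransform.fourier_smul, smul_apply,
      FourierTransform.fourier_sum, sum_apply, smul_eq_mul]
  rw [hu']
  refine (η.hsNorm_sq_le hs _).trans ?_
  rw [SchwartzMap.toLp_fourier_eq]
  have hmeas : ∀ k, Measurable fun w => ‖𝓕 (V k) w‖ₑ ^ 2 := fun k =>
    (𝓕 (V k)).continuous.measurable.enorm.pow_const 2
  have hr : Measurable fun w : E3 => ‖(2 * Real.pi) • w‖ :=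
    (continuous_const_smul (2 * Real.pi)).norm.measurable
  calc ∫⁻ w, ENNReal.ofReal (1 + 600 * ‖(2 * Real.pi) • w‖ ^ 3) * ‖((𝓕 u).toLp 2 volume) w‖ₑ ^ 2
      = ∫⁻ w, ENNReal.ofReal (1 + 600 * ‖(2 * Real.pi) • w‖ ^ 3) * ‖𝓕 u w‖ₑ ^ 2 := by
        refine lintegral_congr_ae ?_
        filter_upwards [(𝓕 u).coeFn_toLp 2 volume] with w hw
        rw [hw]
    _ ≤ ∫⁻ w, ENNReal.ofReal (3602 * c ^ 2) * ∑ k ∈ Finset.range N,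
          (ENNReal.ofReal ((2 ^ k)⁻¹) * (ENNReal.ofReal (‖(2 * Real.pi) • w‖ ^ 4) *
            ‖𝓕 (V k) w‖ₑ ^ 2) + ENNReal.ofReal (8 ^ k) * ‖𝓕 (V k) w‖ₑ ^ 2) := by
        refine lintegral_mono fun w => ?_
        have h := cube_mul_sq_sum_le (norm_nonneg ((2 * Real.pi) • w)) N fun k => ‖𝓕 (V k) w‖
        have hn : ‖𝓕 u w‖ ^ 2 ≤ c ^ 2 * (∑ k ∈ Finset.range N, ‖𝓕 (V k) w‖) ^ 2 := by
          rw [hF, norm_mul, mul_pow, Complex.norm_real, Real.norm_eq_abs, sq_abs]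
          gcongr
          exact norm_sum_le _ _
        have key : (1 + 600 * ‖(2 * Real.pi) • w‖ ^ 3) * ‖𝓕 u w‖ ^ 2 ≤
            3602 * c ^ 2 * ∑ k ∈ Finset.range N, ((2 ^ k)⁻¹ * (‖(2 * Real.pi) • w‖ ^ 4 *
              ‖𝓕 (V k) w‖ ^ 2) + 8 ^ k * ‖𝓕 (V k) w‖ ^ 2) := by
          calc _ ≤ (1 + 600 * ‖(2 * Real.pi) • w‖ ^ 3) *
                (c ^ 2 * (∑ k ∈ Finset.range N, ‖𝓕 (V k) w‖) ^ 2) := by gcongr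
            _ = c ^ 2 * ((1 + 600 * ‖(2 * Real.pi) • w‖ ^ 3) *
                (∑ k ∈ Finset.range N, ‖𝓕 (V k) w‖) ^ 2) := by ring
            _ ≤ c ^ 2 * (3602 * ∑ k ∈ Finset.range N,
                (‖(2 * Real.pi) • w‖ ^ 4 / 2 ^ k + 8 ^ k) * ‖𝓕 (V k) w‖ ^ 2) := by gcongr
            _ = _ := by
              rw [← mul_assoc, mul_comm (c ^ 2)]
              congr 1
              exact Finset.sum_congr rfl fun k _ => by ring
        have hconv : ∀ z : ℂ, ‖z‖ₑ ^ 2 = ENNReal.ofReal (‖z‖ ^ 2) := fun z => by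
          rw [ENNReal.ofReal_pow (norm_nonneg _), ofReal_norm]
        simp only [hconv]
        have hsum : ∑ k ∈ Finset.range N,
            (ENNReal.ofReal ((2 ^ k)⁻¹) * (ENNReal.ofReal (‖(2 * Real.pi) • w‖ ^ 4) *
              ENNReal.ofReal (‖𝓕 (V k) w‖ ^ 2)) +
                ENNReal.ofReal (8 ^ k) * ENNReal.ofReal (‖𝓕 (V k) w‖ ^ 2)) =
            ENNReal.ofReal (∑ k ∈ Finset.range N, ((2 ^ k)⁻¹ * (‖(2 * Real.pi) • w‖ ^ 4 *
              ‖𝓕 (V k) w‖ ^ 2) + 8 ^ k * ‖𝓕 (V k) w‖ ^ 2)) := by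
          rw [ENNReal.ofReal_sum_of_nonneg fun k _ => by positivity]
          refine Finset.sum_congr rfl fun k _ => ?_
          rw [ENNReal.ofReal_add (by positivity) (by positivity), ENNReal.ofReal_mul (by positivity),
            ENNReal.ofReal_mul (by positivity), ENNReal.ofReal_mul (by positivity)]
        rw [hsum, ← ENNReal.ofReal_mul (by positivity), ← ENNReal.ofReal_mul (by positivity)]
        exact ENNReal.ofReal_le_ofReal key
    _ = _ := by
        have hm4 : ∀ k, Measurable fun w => ENNReal.ofReal (‖(2 * Real.pi) • w‖ ^ 4) *
            ‖𝓕 (V k) w‖ₑ ^ 2 := fun k => (hr.pow_const 4).ennreal_ofReal.mul (hmeas k)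
        have hm5 : ∀ k, Measurable fun w =>
            ENNReal.ofReal ((2 ^ k)⁻¹) * (ENNReal.ofReal (‖(2 * Real.pi) • w‖ ^ 4) *
              ‖𝓕 (V k) w‖ₑ ^ 2) + ENNReal.ofReal (8 ^ k) * ‖𝓕 (V k) w‖ₑ ^ 2 := fun k =>
          ((hm4 k).const_mul _).add ((hmeas k).const_mul _)
        rw [lintegral_const_mul _ (Finset.measurable_fun_sum _ fun k _ => hm5 k),
          lintegral_finsetSum _ fun k _ => hm5 k]
        congr 1
        refine Finset.sum_congr rfl fun k _ => ?_
        rw [lintegral_add_left ((hm4 k).const_mul _), lintegral_const_mul _ (hm4 k),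
          lintegral_const_mul _ (hmeas k), lintegral_fourth_mul_enorm_fourier_sq,
          lintegral_enorm_fourier_sq]
        simp only [laplacian_ofReal_apply (hv k) (V k) (fun x => rfl), enorm_ofReal]
        congr 3
        exact funext fun x => by rw [hV]; simp only [toSchwartz_apply, enorm_ofReal]

/-! ### Derivatives of radial functions -/

theorem pd_radial {F : ℝ → ℝ} {x : E3} (hF : DifferentiableAt ℝ F (‖x‖ ^ 2)) (i : Fin 3) :
    pd i (fun y => F (‖y‖ ^ 2)) x = 2 * x i * deriv F (‖x‖ ^ 2) := by
  have h := (hF.hasDerivAt.comp_hasFDerivAt x (hasStrictFDerivAt_norm_sq x).hasFDerivAt).fderiv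
  have h' := congrArg (fun A : E3 →L[ℝ] ℝ => A (EuclideanSpace.single i 1)) h
  simp only [Function.comp_def] at h'
  rw [pd, h']
  simp [EuclideanSpace.inner_single_right]
  ring

theorem pd_coord (i m : Fin 3) (x : E3) : pd i (fun y => y m) x = if m = i then 1 else 0 := by
  have h : HasFDerivAt (fun y : E3 => y m) (EuclideanSpace.proj m : E3 →L[ℝ] ℝ) x :=
    (EuclideanSpace.proj m : E3 →L[ℝ] ℝ).hasFDerivAt
  rw [pd, h.fderiv]
  simp

theorem differentiable_radial {F : ℝ → ℝ} (hF : Differentiable ℝ F) :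
    Differentiable ℝ fun y : E3 => F (‖y‖ ^ 2) :=
  hF.comp (differentiable_id.norm_sq ℝ)

theorem contDiff_radial {F : ℝ → ℝ} (hF : ContDiff ℝ ∞ F) :
    ContDiff ℝ ∞ fun y : E3 => F (‖y‖ ^ 2) :=
  hF.comp (contDiff_norm_sq ℝ)

theorem pd_const_mul {v : E3 → ℝ} {x : E3} (hv : DifferentiableAt ℝ v x) (c : ℝ) (i : Fin 3) :
    pd i (fun y => c * v y) x = c * pd i v x := by
  rw [pd, fderiv_const_mul hv]; rfl

theorem differentiable_coord (i : Fin 3) : Differentiable ℝ fun y : E3 => y i :=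
  (EuclideanSpace.proj i : E3 →L[ℝ] ℝ).differentiable

theorem pd_radial_mul_linear {F : ℝ → ℝ} (hF : Differentiable ℝ F) (a b c : ℝ) (i j m n : Fin 3)
    (x : E3) :
    pd n (fun y => F (‖y‖ ^ 2) * (a * y i + b * y j - c * y m)) x =
      2 * x n * deriv F (‖x‖ ^ 2) * (a * x i + b * x j - c * x m) +
        F (‖x‖ ^ 2) * (a * (if i = n then 1 else 0) + b * (if j = n then 1 else 0) -
          c * (if m = n then 1 else 0)) := by
  have hR := differentiable_radial hF x
  have hl : ∀ (r : ℝ) (k : Fin 3), DifferentiableAt ℝ (fun y : E3 => r * y k) x := fun r k =>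
    ((differentiable_coord k).const_mul r) x
  have h1 := fderiv_fun_mul hR (((hl a i).fun_add (hl b j)).fun_sub (hl c m))
  have h2 : fderiv ℝ (fun y : E3 => a * y i + b * y j - c * y m) x (EuclideanSpace.single n 1) =
      pd n (fun y => a * y i) x + pd n (fun y => b * y j) x - pd n (fun y => c * y m) x := by
    rw [fderiv_fun_sub ((hl a i).fun_add (hl b j)) (hl c m), fderiv_fun_add (hl a i) (hl b j)]
    rfl
  rw [pd_const_mul (differentiable_coord i x), pd_const_mul (differentiable_coord j x),
    pd_const_mul (differentiable_coord m x), pd_coord, pd_coord, pd_coord] at h2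
  have h3 : fderiv ℝ (fun y : E3 => F (‖y‖ ^ 2)) x (EuclideanSpace.single n 1) =
      2 * x n * deriv F (‖x‖ ^ 2) := pd_radial (hF _) n
  rw [pd, h1]
  simp only [_root_.add_apply, _root_.smul_apply, smul_eq_mul, h2, h3]
  ring

theorem lap_radial {F : ℝ → ℝ} (hF : ContDiff ℝ ∞ F) (x : E3) :
    lap (fun y => F (‖y‖ ^ 2)) x =
      4 * ‖x‖ ^ 2 * deriv (deriv F) (‖x‖ ^ 2) + 6 * deriv F (‖x‖ ^ 2) := by
  have hF' : Differentiable ℝ (deriv F) :=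
    ((contDiff_infty_iff_deriv.1 hF).2).differentiable (by simp)
  have h1 : ∀ i, pd i (fun y => F (‖y‖ ^ 2)) =
      fun y => deriv F (‖y‖ ^ 2) * (2 * y i + 0 * y i - 0 * y i) := fun i => funext fun y => by
    rw [pd_radial (hF.differentiable (by simp) _)]; ring
  simp only [lap, h1, pd_radial_mul_linear hF']
  have hx := EuclideanSpace.real_norm_sq_eq x
  rw [Fin.sum_univ_three] at hx ⊢
  generalize deriv (deriv F) (‖x‖ ^ 2) = P
  generalize deriv F (‖x‖ ^ 2) = L
  rw [hx]
  simp
  ring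

/-! ### Radial conformally flat metrics -/

/-- The conformally flat metric `Φ(|x|²) δ`. -/
noncomputable def confMetric (Φ : ℝ → ℝ) : Tensor2 := fun x => Φ (‖x‖ ^ 2) • 1

theorem confMetric_apply (Φ : ℝ → ℝ) (x : E3) (i j : Fin 3) :
    confMetric Φ x i j = (if i = j then 1 else 0) * Φ (‖x‖ ^ 2) := by
  simp [confMetric, Matrix.one_apply]

/-- The logarithmic derivative of the conformal factor with respect to `s = |x|²`. -/
noncomputable def logSlope (Φ : ℝ → ℝ) (s : ℝ) : ℝ := deriv Φ s / Φ s

theorem ginv_confMetric (Φ : ℝ → ℝ) (x : E3) (i j : Fin 3) :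
    ginv (confMetric Φ) x i j = if i = j then (Φ (‖x‖ ^ 2))⁻¹ else 0 := by
  rw [ginv, confMetric]
  have h : (Φ (‖x‖ ^ 2) • (1 : Matrix (Fin 3) (Fin 3) ℝ))⁻¹ = (Φ (‖x‖ ^ 2))⁻¹ • 1 := by
    rcases eq_or_ne (Φ (‖x‖ ^ 2)) 0 with h0 | h0
    · simp [h0]
    · apply Matrix.inv_eq_right_inv
      rw [Matrix.smul_mul, Matrix.mul_smul, smul_smul, mul_inv_cancel₀ h0, one_mul, one_smul]
  rw [h, Matrix.smul_apply, Matrix.one_apply, smul_eq_mul]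
  split_ifs <;> simp

section

variable {Φ : ℝ → ℝ} (hΦ : ContDiff ℝ ∞ Φ)
include hΦ

theorem pd_confMetric (i j l : Fin 3) (x : E3) :
    pd i (fun y => confMetric Φ y j l) x =
      (if j = l then 1 else 0) * (2 * x i * deriv Φ (‖x‖ ^ 2)) := by
  have hd := hΦ.differentiable (by simp)
  simp only [confMetric_apply]
  rw [pd_const_mul (differentiable_radial hd x), pd_radial (hd _)]

theorem christoffel_confMetric (m i j : Fin 3) :
    christoffel (confMetric Φ) m i j = fun x => logSlope Φ (‖x‖ ^ 2) *
      ((if j = m then 1 else 0) * x i + (if i = m then 1 else 0) * x j -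
        (if i = j then 1 else 0) * x m) := by
  funext x
  simp only [christoffel, pd_confMetric hΦ, ginv_confMetric, ite_mul, zero_mul, Finset.sum_ite_eq,
    Finset.mem_univ, if_true, logSlope]
  split_ifs <;> ring

/-- The metric is parallel. -/
theorem divergence_confMetric_zero (hpos : ∀ s, 0 < Φ s) (β : ℝ) (x : E3) (j : Fin 3) :
    divergence (confMetric Φ) (fun x => -β • confMetric Φ x) j x = 0 := by
  have h0 := (hpos (‖x‖ ^ 2)).ne'
  have h : ∀ a i, covDeriv (confMetric Φ) (fun x => -β • confMetric Φ x) a i j x = 0 := fun a i => by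
    have hd : DifferentiableAt ℝ (fun y : E3 => confMetric Φ y i j) x := by
      simp only [confMetric_apply]
      exact ((differentiable_radial (hΦ.differentiable (by simp))).const_mul _) x
    have hp : pd a (fun y => (-β • confMetric Φ y) i j) x =
        -β * ((if i = j then 1 else 0) * (2 * x a * deriv Φ (‖x‖ ^ 2))) := by
      simp only [Matrix.smul_apply, smul_eq_mul]
      rw [pd_const_mul hd, pd_confMetric hΦ]
    rw [covDeriv, hp]
    simp only [Matrix.smul_apply, smul_eq_mul, christoffel_confMetric hΦ, confMetric_apply,
      logSlope, mul_ite, ite_mul, one_mul, mul_zero, zero_mul, Finset.sum_ite_eq,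
      Finset.sum_ite_eq', Finset.mem_univ, if_true]
    generalize deriv Φ (‖x‖ ^ 2) = d
    generalize Φ (‖x‖ ^ 2) = p at h0
    clear hd hp
    split_ifs <;> field_simp <;> grind
  simp only [divergence, h, mul_zero, Finset.sum_const_zero]

variable (hpos : ∀ s, 0 < Φ s)
include hpos

theorem contDiff_logSlope : ContDiff ℝ ∞ (logSlope Φ) :=
  ((contDiff_infty_iff_deriv.1 hΦ).2).div hΦ fun s => (hpos s).ne'

theorem scalarCurvature_confMetric (x : E3) :
    scalarCurvature (confMetric Φ) x = (Φ (‖x‖ ^ 2))⁻¹ *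
      (-8 * ‖x‖ ^ 2 * deriv (logSlope Φ) (‖x‖ ^ 2) - 12 * logSlope Φ (‖x‖ ^ 2) -
        2 * ‖x‖ ^ 2 * logSlope Φ (‖x‖ ^ 2) ^ 2) := by
  have hL := (contDiff_logSlope hΦ hpos).differentiable (by simp)
  have hR : ∀ i, ricci (confMetric Φ) i i x = -2 * deriv (logSlope Φ) (‖x‖ ^ 2) * x i ^ 2
      - 2 * deriv (logSlope Φ) (‖x‖ ^ 2) * ‖x‖ ^ 2 - 4 * logSlope Φ (‖x‖ ^ 2)
      + logSlope Φ (‖x‖ ^ 2) ^ 2 * (x i ^ 2 - ‖x‖ ^ 2) := fun i => by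
    simp only [ricci, christoffel_confMetric hΦ, pd_radial_mul_linear hL, Fin.sum_univ_three]
    generalize deriv (logSlope Φ) (‖x‖ ^ 2) = P
    generalize logSlope Φ (‖x‖ ^ 2) = L
    rw [EuclideanSpace.real_norm_sq_eq, Fin.sum_univ_three]
    fin_cases i <;> simp <;> ring
  simp only [scalarCurvature, ginv_confMetric, ite_mul, zero_mul, Finset.sum_ite_eq,
    Finset.mem_univ, if_true, hR]
  rw [← Finset.mul_sum]
  congr 1
  rw [Fin.sum_univ_three]
  have := EuclideanSpace.real_norm_sq_eq x
  rw [Fin.sum_univ_three] at this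
  generalize deriv (logSlope Φ) (‖x‖ ^ 2) = P
  generalize logSlope Φ (‖x‖ ^ 2) = L
  rw [this]
  ring

end

/-! ### Umbilic initial data with a conformally flat metric -/

/-- The scalar curvature of `Φ(|x|²) δ` as a function of `s = |x|²`. -/
noncomputable def radialCurvature (Φ : ℝ → ℝ) (s : ℝ) : ℝ :=
  (Φ s)⁻¹ * (-8 * s * deriv (logSlope Φ) s - 12 * logSlope Φ s - 2 * s * logSlope Φ s ^ 2)

theorem trace_confMetric {Φ : ℝ → ℝ} (hpos : ∀ s, 0 < Φ s) (β : ℝ) :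
    trace (confMetric Φ) (fun x => -β • confMetric Φ x) = fun _ => -3 * β := by
  funext x
  have h0 := (hpos (‖x‖ ^ 2)).ne'
  simp only [trace, ginv_confMetric, Matrix.smul_apply, confMetric_apply, smul_eq_mul, ite_mul,
    zero_mul, Finset.sum_ite_eq, Finset.mem_univ, if_true, one_mul, Fin.sum_univ_three]
  field_simp
  ring

theorem normSqTensor_confMetric {Φ : ℝ → ℝ} (hpos : ∀ s, 0 < Φ s) (β : ℝ)
    (x : E3) :
    normSqTensor (confMetric Φ) (fun x => -β • confMetric Φ x) x = 3 * β ^ 2 := by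
  have h0 := (hpos (‖x‖ ^ 2)).ne'
  simp only [normSqTensor, ginv_confMetric, Matrix.smul_apply, confMetric_apply, smul_eq_mul,
    ite_mul, mul_ite, zero_mul, mul_zero, Finset.sum_ite_eq, Finset.mem_univ, if_true, one_mul,
    Fin.sum_univ_three]
  simp
  field_simp
  ring

section

variable {Φ : ℝ → ℝ} (hΦ : ContDiff ℝ ∞ Φ) (hpos : ∀ s, 0 < Φ s)
include hΦ hpos

theorem contDiff_radialCurvature : ContDiff ℝ ∞ (radialCurvature Φ) := by
  have hL := contDiff_logSlope hΦ hpos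
  have hL' : ContDiff ℝ ∞ (deriv (logSlope Φ)) := (contDiff_infty_iff_deriv.1 hL).2
  exact (hΦ.inv fun s => (hpos s).ne').mul ((((contDiff_const.mul contDiff_id).mul hL').sub
    (contDiff_const.mul hL)).sub ((contDiff_const.mul contDiff_id).mul (hL.pow 2)))

/-- A decreasing concave conformal factor (as a function of `|x|²`) gives nonnegative scalar
curvature; the gradient term in the curvature has a favourable sign. -/
theorem radialCurvature_nonneg {s : ℝ} (hs : 0 ≤ s) (h1 : deriv Φ s ≤ 0)
    (h2 : deriv (deriv Φ) s ≤ 0) : 0 ≤ radialCurvature Φ s := by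
  have hp := hpos s
  have hd : deriv (logSlope Φ) s = deriv (deriv Φ) s / Φ s - logSlope Φ s ^ 2 := by
    have hΦ' : DifferentiableAt ℝ (deriv Φ) s :=
      ((contDiff_infty_iff_deriv.1 hΦ).2).differentiable (by simp) s
    have := deriv_fun_div hΦ' (hΦ.differentiable (by simp) s) hp.ne'
    rw [show logSlope Φ = fun t => deriv Φ t / Φ t from rfl, this]
    field_simp
  have hL : logSlope Φ s ≤ 0 := div_nonpos_of_nonpos_of_nonneg h1 hp.le
  have hQ : deriv (deriv Φ) s / Φ s ≤ 0 := div_nonpos_of_nonpos_of_nonneg h2 hp.le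
  rw [radialCurvature, hd]
  refine mul_nonneg (inv_nonneg.2 hp.le) ?_
  nlinarith [mul_nonneg hs (neg_nonneg.2 hQ), mul_nonneg hs (sq_nonneg (logSlope Φ s))]

theorem isInitialData_confMetric (h1 : ∀ s, 0 ≤ s → s < 1 → deriv Φ s ≤ 0)
    (h2 : ∀ s, 0 ≤ s → s < 1 → deriv (deriv Φ) s ≤ 0) {β : ℝ} (hβ : 0 < β) :
    IsInitialData unitBall (confMetric Φ) (fun x => -β • confMetric Φ x) (fun _ => 0)
      (fun x => √(radialCurvature Φ (‖x‖ ^ 2) + 6 * β ^ 2)) := by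
  have hg : ∀ i j, ContDiff ℝ ∞ fun x => confMetric Φ x i j := fun i j => by
    simp only [confMetric_apply]
    exact contDiff_const.mul (contDiff_radial hΦ)
  have hR : ∀ x ∈ unitBall, 0 < radialCurvature Φ (‖x‖ ^ 2) + 6 * β ^ 2 := fun x hx => by
    rw [mem_ball_zero_iff] at hx
    have hs : ‖x‖ ^ 2 < 1 := by nlinarith [norm_nonneg x]
    have := radialCurvature_nonneg hΦ hpos (sq_nonneg ‖x‖) (h1 _ (sq_nonneg _) hs)
      (h2 _ (sq_nonneg _) hs)
    positivity
  refine ⟨fun i j => (hg i j).contDiffOn, fun i j => ?_, contDiffOn_const, ?_, fun x _ => ?_,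
    fun x _ => ?_, fun x hx => ?_, fun x _ j => ?_⟩
  · exact (contDiff_const.mul (hg i j)).contDiffOn
  · exact ((contDiff_radial (contDiff_radialCurvature hΦ hpos)).add contDiff_const).contDiffOn.sqrt
      fun x hx => (hR x hx).ne'
  · exact Matrix.PosDef.one.smul (hpos _)
  · exact ((Matrix.isSymm_one).smul _).smul _
  · have hgrad : normSqGrad (confMetric Φ) (fun _ => 0) x = 0 := by simp [normSqGrad, pd]
    rw [scalarCurvature_confMetric hΦ hpos, trace_confMetric hpos, normSqTensor_confMetric hpos,
      hgrad, Real.sq_sqrt (hR x hx).le, radialCurvature]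
    ring
  · rw [divergence_confMetric_zero hΦ hpos, trace_confMetric hpos]
    simp [pd]

end

theorem norm_act {A : Matrix (Fin 3) (Fin 3) ℝ} (hA : A ∈ Matrix.orthogonalGroup (Fin 3) ℝ)
    (x : E3) : ‖act A x‖ = ‖x‖ := by
  have h : ‖act A x‖ ^ 2 = ‖x‖ ^ 2 := by
    rw [EuclideanSpace.real_norm_sq_eq, EuclideanSpace.real_norm_sq_eq]
    have hdot : ∀ v : Fin 3 → ℝ, ∑ i, v i ^ 2 = v ⬝ᵥ v := fun v => by
      simp [dotProduct, sq]
    rw [hdot, hdot, act]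
    have hA' : A.transpose * A = 1 := (Matrix.mem_orthogonalGroup_iff' (Fin 3) ℝ).1 hA
    simp only
    rw [Matrix.dotProduct_mulVec, Matrix.vecMul_mulVec, ← Matrix.dotProduct_mulVec, hA',
      Matrix.one_mulVec]
  exact (pow_left_inj₀ (norm_nonneg _) (norm_nonneg _) two_ne_zero).1 h

theorem isSphericallySymmetric_confMetric (Φ : ℝ → ℝ) (β : ℝ) (F : ℝ → ℝ) :
    IsSphericallySymmetric (confMetric Φ) (fun x => -β • confMetric Φ x) (fun _ => 0)
      (fun x => F (‖x‖ ^ 2)) := by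
  have hg : ∀ A ∈ Matrix.orthogonalGroup (Fin 3) ℝ, ∀ x,
      A.transpose * confMetric Φ (act A x) * A = confMetric Φ x := fun A hA x => by
    have hA' : A.transpose * A = 1 := (Matrix.mem_orthogonalGroup_iff' (Fin 3) ℝ).1 hA
    simp [confMetric, norm_act hA, hA']
  refine ⟨fun A hA x _ => hg A hA x, fun A hA x _ => ?_, fun _ _ _ _ => rfl, fun A hA x _ => ?_⟩
  · rw [Matrix.mul_smul, Matrix.smul_mul, hg A hA x]
  · simp only [norm_act hA]

/-! ### The minimal sphere -/

theorem fact_finrank_E3 : Fact (Module.finrank ℝ E3 = 2 + 1) := ⟨finrank_euclideanSpace_fin⟩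

theorem contMDiff_coe_S2 : ContMDiff (𝓡 2) 𝓘(ℝ, E3) ∞ ((↑) : S2 → E3) :=
  haveI := fact_finrank_E3
  contMDiff_coe_sphere (n := 2) (E := E3)

theorem injective_mfderiv_coe_S2 (p : S2) :
    Function.Injective (mfderiv (𝓡 2) 𝓘(ℝ, E3) ((↑) : S2 → E3) p) := by
  have := fact_finrank_E3
  exact injective_mvfderiv_subtypeVal_sphere (n := 2) (E := E3) p

theorem inner_mfderiv_coe_S2 (p : S2) (v : TangentSpace (𝓡 2) p) :
    inner ℝ (p : E3) (mfderiv (𝓡 2) 𝓘(ℝ, E3) ((↑) : S2 → E3) p v : E3) = 0 := by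
  have := fact_finrank_E3
  have h : (mfderiv (𝓡 2) 𝓘(ℝ, E3) ((↑) : S2 → E3) p v : E3) ∈ (Submodule.span ℝ {(p : E3)})ᗮ := by
    rw [← range_mvfderiv_subtypeVal (n := 2) (E := E3) p]
    exact ⟨v, rfl⟩
  exact Submodule.mem_orthogonal_singleton_iff_inner_right.1 h

theorem mfderiv_smul_coe_S2 (r : ℝ) (p : S2) :
    mfderiv (𝓡 2) 𝓘(ℝ, E3) (fun p : S2 => r • (p : E3)) p =
      r • mfderiv (𝓡 2) 𝓘(ℝ, E3) ((↑) : S2 → E3) p :=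
  const_smul_mfderiv (contMDiff_coe_S2.mdifferentiable (by simp) p) r

theorem isEmbeddedSphere_smul {r : ℝ} (hr : r ≠ 0) :
    IsEmbeddedSphere fun p : S2 => r • (p : E3) := by
  refine ⟨?_, fun p q h => ?_, fun p => ?_⟩
  · exact (contDiff_const_smul r).contMDiff.comp contMDiff_coe_S2
  · exact Subtype.ext (smul_right_injective E3 hr h)
  · rw [mfderiv_smul_coe_S2]
    exact (smul_right_injective E3 hr).comp (injective_mfderiv_coe_S2 p)

theorem inner_eq_zero_of_isTangent {r : ℝ} {p : S2} {X : E3}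
    (hX : IsTangent (fun p : S2 => r • (p : E3)) p X) : ∑ i, (p : E3) i * X i = 0 := by
  obtain ⟨v, hv⟩ := hX
  rw [mfderiv_smul_coe_S2] at hv
  obtain ⟨w, hw, rfl⟩ : ∃ w : E3, inner ℝ (p : E3) w = 0 ∧ r • w = X :=
    ⟨_, inner_mfderiv_coe_S2 p v, hv⟩
  have h' : inner ℝ (p : E3) (r • w) = 0 := by rw [inner_smul_right, hw, mul_zero]
  rw [PiLp.inner_apply] at h'
  refine Eq.trans (Finset.sum_congr rfl fun i _ => ?_) h'
  exact mul_comm _ _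

/-- If the area `4π s Φ(s)` of the coordinate spheres `|x|² = s` is stationary at `s₀`, then
`|x|² = s₀` is totally geodesic, hence trapped for `k = -β g`, `β > 0`. -/
theorem isTrappedSphere_confMetric {Φ : ℝ → ℝ} (hΦ : ContDiff ℝ ∞ Φ) (hpos : ∀ s, 0 < Φ s)
    {s₀ : ℝ} (h0 : 0 < s₀) (h1 : s₀ < 1) (hmin : Φ s₀ + s₀ * deriv Φ s₀ = 0) {β : ℝ} (hβ : 0 < β) :
    IsTrappedSphere unitBall (confMetric Φ) (fun x => -β • confMetric Φ x)
      (fun p : S2 => √s₀ • (p : E3)) := by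
  have hs : 0 < √s₀ := Real.sqrt_pos.2 h0
  have hp := hpos s₀
  have hnorm : ∀ p : S2, ‖√s₀ • (p : E3)‖ ^ 2 = s₀ := fun p => by
    rw [norm_smul, norm_eq_of_mem_sphere, mul_one, Real.norm_of_nonneg hs.le, Real.sq_sqrt h0.le]
  have hev : ∀ (p : S2) (X Y : E3), ev (confMetric Φ) (√s₀ • (p : E3)) X Y =
      Φ s₀ * ∑ i, X i * Y i := fun p X Y => by
    simp only [ev, confMetric_apply, hnorm, ite_mul, zero_mul, one_mul, Finset.sum_ite_eq,
      Finset.mem_univ, if_true]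
    rw [Finset.mul_sum]
    exact Finset.sum_congr rfl fun i _ => by ring
  have hevk : ∀ (x X Y : E3), ev (fun x => -β • confMetric Φ x) x X Y =
      -β * ev (confMetric Φ) x X Y := fun x X Y => by
    simp only [ev, Matrix.smul_apply, smul_eq_mul, Finset.mul_sum]
    exact Finset.sum_congr rfl fun i _ => Finset.sum_congr rfl fun j _ => by ring
  -- The normal field is the linear field `c x`, of unit length on `|x|² = s₀`.
  set c : ℝ := (√(s₀ * Φ s₀))⁻¹ with hc
  have hc2 : Φ s₀ * (c ^ 2 * s₀) = 1 := by
    rw [hc, inv_pow, Real.sq_sqrt (by positivity)]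
    field_simp
  refine ⟨isEmbeddedSphere_smul hs.ne', ?_, fun x => c • x, ⟨⟨Set.univ, isOpen_univ,
    Set.subset_univ _, (contDiff_const_smul c).contDiffOn⟩, fun p X hX => ?_, fun p => ?_⟩, ?_⟩
  · rintro _ ⟨p, rfl⟩
    rw [mem_ball_zero_iff]
    have := hnorm p
    nlinarith [norm_nonneg (√s₀ • (p : E3))]
  · rw [hev]
    have h := inner_eq_zero_of_isTangent hX
    have : ∑ i, (c • √s₀ • (p : E3)) i * X i = c * √s₀ * ∑ i, (p : E3) i * X i := by
      rw [Finset.mul_sum]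
      exact Finset.sum_congr rfl fun i _ => by simp; ring
    rw [this, h, mul_zero, mul_zero]
  · have h := hnorm p
    rw [EuclideanSpace.real_norm_sq_eq] at h
    have h' : ∑ i, (c • √s₀ • (p : E3)) i * (c • √s₀ • (p : E3)) i =
        c ^ 2 * ∑ i, (√s₀ • (p : E3)) i ^ 2 := by
      rw [Finset.mul_sum]
      exact Finset.sum_congr rfl fun i _ => by simp; ring
    rw [hev, h', h, hc2]
  -- `∇_X (c x) = c (1 + s Φ'(s) / Φ(s)) X` on `|x|² = s`, which vanishes for `s = s₀`.
  · have hcov : ∀ (p : S2) (X : E3),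
        covDerivVec (confMetric Φ) (fun x => c • x) (√s₀ • (p : E3)) X = 0 := fun p X => by
      have hx := hnorm p
      generalize √s₀ • (p : E3) = x at hx
      have hx' := EuclideanSpace.real_norm_sq_eq x
      rw [hx, Fin.sum_univ_three] at hx'
      have hL : 1 + s₀ * logSlope Φ s₀ = 0 := by
        rw [logSlope]; field_simp; linarith
      ext m
      have hpd : ∀ a, pd a (fun y : E3 => (c • y) m) x = c * if m = a then 1 else 0 := fun a => by
        rw [← pd_coord a m x, ← pd_const_mul (differentiable_coord m x)]
        rfl
      simp only [covDerivVec, hpd, christoffel_confMetric hΦ, hx]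
      generalize logSlope Φ s₀ = l at hL
      have h : c * X m * (1 + s₀ * l) = 0 := by rw [hL, mul_zero]
      rw [hx'] at h
      refine Eq.trans ?_ h
      simp only [Fin.sum_univ_three]
      clear hpd h
      fin_cases m <;> simp <;> ring
    intro p X Y hXY
    have hsff : ∀ X Y, secondFF (confMetric Φ) (fun x => c • x) (√s₀ • (p : E3)) X Y = 0 :=
      fun X Y => by rw [secondFF, hcov, ev]; simp
    have hX := hXY.unit_left
    have hY := hXY.unit_right
    rw [hsff, hsff, hevk, hevk, hX, hY]
    constructor <;> linarith

/-! ### Superposition of dyadic profiles -/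

/-- A one-dimensional profile: smooth, supported in `[-1, 2]`, concave and decreasing on
`(-∞, 0]`, with slope `-2` at `0`. -/
structure IsProfile (V : ℝ → ℝ) : Prop where
  smooth : ContDiff ℝ ∞ V
  eq_zero_left : ∀ t ≤ -1, V t = 0
  eq_zero_right : ∀ t, 2 ≤ t → V t = 0
  deriv_nonpos : ∀ t ≤ 0, deriv V t ≤ 0
  deriv_deriv_nonpos : ∀ t ≤ 0, deriv (deriv V) t ≤ 0
  deriv_zero : deriv V 0 = -2

/-- On `(-∞, 1]` the profile is a negative multiple of a primitive of the increasing function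
`expNegInvGlue (t + 1)`; it is cut off on `[1, 2]`. -/
theorem exists_isProfile : ∃ V, IsProfile V := by
  set a : ℝ := 2 / expNegInvGlue 1 with ha
  have he : 0 < expNegInvGlue 1 := expNegInvGlue.pos_of_pos one_pos
  have ha0 : 0 < a := by positivity
  set G : ℝ → ℝ := fun t => expNegInvGlue (t + 1) with hG
  have hGs : ContDiff ℝ ∞ G := expNegInvGlue.contDiff.comp (contDiff_id.add contDiff_const)
  have hGm : Monotone G := fun s t h => expNegInvGlue.monotone (by linarith)
  set I : ℝ → ℝ := fun t => ∫ x in (-1 : ℝ)..t, G x with hI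
  have hId : ∀ t, HasDerivAt I (G t) t := fun t => hGs.continuous.integral_hasStrictDerivAt _ _
    |>.hasDerivAt
  have hIs : ContDiff ℝ ∞ I := by
    rw [contDiff_infty_iff_deriv]
    exact ⟨fun t => (hId t).differentiableAt, by rwa [show deriv I = G from
      funext fun t => (hId t).deriv]⟩
  have hloc : ∀ t < 1, (fun t => -a * I t * Real.smoothTransition (2 - t)) =ᶠ[nhds t]
      fun t => -a * I t := fun t ht => by
    filter_upwards [Iio_mem_nhds ht] with r hr
    rw [Real.smoothTransition.one_of_one_le (by rw [Set.mem_Iio] at hr; linarith), mul_one]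
  have hd : ∀ t < 1, deriv (fun t => -a * I t * Real.smoothTransition (2 - t)) t = -a * G t :=
    fun t ht => by rw [(hloc t ht).deriv_eq, ((hId t).const_mul (-a)).deriv]
  refine ⟨fun t => -a * I t * Real.smoothTransition (2 - t), ?_, fun t ht => ?_, fun t ht => ?_,
    fun t ht => ?_, fun t ht => ?_, ?_⟩
  · exact (contDiff_const.mul hIs).mul (Real.smoothTransition.contDiff.comp
      (contDiff_const.sub contDiff_id))
  · have : I t = 0 := by
      rw [hI]
      refine intervalIntegral.integral_zero_ae (Filter.Eventually.of_forall fun x hx => ?_)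
      rw [Set.uIoc_of_ge ht] at hx
      exact expNegInvGlue.zero_of_nonpos (by linarith [hx.2])
    simp [this]
  · rw [Real.smoothTransition.zero_of_nonpos (by linarith), mul_zero]
  · rw [hd t (by linarith)]
    have : 0 ≤ G t := expNegInvGlue.nonneg _
    nlinarith
  · have : deriv (fun t => -a * I t * Real.smoothTransition (2 - t)) =ᶠ[nhds t]
        fun t => -a * G t := by
      filter_upwards [Iio_mem_nhds (by linarith : t < 1)] with r hr using hd r hr
    rw [this.deriv_eq, deriv_const_mul _ (hGs.differentiable (by simp) t)]
    have : 0 ≤ deriv G t := hGm.deriv_nonneg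
    nlinarith
  · rw [hd 0 one_pos, hG, ha]
    simp only [zero_add]
    field_simp

namespace IsProfile

variable {V : ℝ → ℝ} (hV : IsProfile V)
include hV

theorem hasCompactSupport : HasCompactSupport V := by
  refine HasCompactSupport.of_support_subset_isCompact (isCompact_Icc (a := -1) (b := 2)) fun t ht => ?_
  rw [Function.mem_support] at ht
  exact ⟨le_of_not_ge fun h => ht (hV.eq_zero_left t h),
    le_of_not_ge fun h => ht (hV.eq_zero_right t h)⟩

theorem contDiff_deriv : ContDiff ℝ ∞ (deriv V) := (contDiff_infty_iff_deriv.1 hV.smooth).2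

theorem contDiff_deriv_deriv : ContDiff ℝ ∞ (deriv (deriv V)) :=
  (contDiff_infty_iff_deriv.1 hV.contDiff_deriv).2

theorem exists_bound : ∃ M : ℝ, 0 < M ∧
    ∀ t, |V t| ≤ M ∧ |deriv V t| ≤ M ∧ |deriv (deriv V) t| ≤ M := by
  obtain ⟨A, hA⟩ := hV.hasCompactSupport.exists_bound_of_continuous hV.smooth.continuous
  obtain ⟨B, hB⟩ := hV.hasCompactSupport.deriv.exists_bound_of_continuous hV.contDiff_deriv.continuous
  obtain ⟨C, hC⟩ := hV.hasCompactSupport.deriv.deriv.exists_bound_of_continuous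
    hV.contDiff_deriv_deriv.continuous
  have hA0 := (norm_nonneg _).trans (hA 0)
  have hB0 := (norm_nonneg _).trans (hB 0)
  have hC0 := (norm_nonneg _).trans (hC 0)
  refine ⟨A + B + C + 1, by positivity, fun t => ⟨?_, ?_, ?_⟩⟩
  · have := hA t; rw [Real.norm_eq_abs] at this; linarith
  · have := hB t; rw [Real.norm_eq_abs] at this; linarith
  · have := hC t; rw [Real.norm_eq_abs] at this; linarith

end IsProfile

/-- The rescaling of `V` to the scale `2^{-(k+1)}` around `s = 1`, normalized so that its slope does
not depend on `k`. -/
noncomputable def dyadicProfile (V : ℝ → ℝ) (k : ℕ) (s : ℝ) : ℝ :=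
  (2 ^ (k + 1))⁻¹ * V (2 ^ (k + 1) * (s - 1))

/-- The average of the first `N` dyadic profiles. All of them have the same slope at `s = 1`, so the
average keeps it, while its `H^{3/2}` norm is of size `N^{-1/2}`. -/
noncomputable def averagedProfile (V : ℝ → ℝ) (N : ℕ) (s : ℝ) : ℝ :=
  (N : ℝ)⁻¹ * ∑ k ∈ Finset.range N, dyadicProfile V k s

theorem hasDerivAt_comp_scale {W : ℝ → ℝ} (hW : Differentiable ℝ W) (k : ℕ) (s : ℝ) :
    HasDerivAt (fun s => W (2 ^ (k + 1) * (s - 1)))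
      (deriv W (2 ^ (k + 1) * (s - 1)) * 2 ^ (k + 1)) s := by
  have h : HasDerivAt (fun s : ℝ => (2 : ℝ) ^ (k + 1) * (s - 1)) (2 ^ (k + 1)) s := by
    simpa using ((hasDerivAt_id s).sub_const 1).const_mul ((2 : ℝ) ^ (k + 1))
  exact (hW _).hasDerivAt.comp s h

theorem abs_averagedProfile_le {V : ℝ → ℝ} {M : ℝ} (hM : ∀ t, |V t| ≤ M) (N : ℕ) (s : ℝ) :
    |averagedProfile V N s| ≤ 2 * M / N := by
  have hM0 : 0 ≤ M := (abs_nonneg _).trans (hM 0)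
  have h : ∑ k ∈ Finset.range N, |dyadicProfile V k s| ≤ M * 2 := by
    refine le_trans (Finset.sum_le_sum fun k _ => ?_)
      ((Finset.mul_sum _ _ _).symm.le.trans (mul_le_mul_of_nonneg_left (sum_geometric_two_le N) hM0))
    rw [dyadicProfile, abs_mul, abs_of_pos (by positivity), mul_comm M, one_div, inv_pow]
    refine mul_le_mul (inv_anti₀ (by positivity) ?_) (hM _) (abs_nonneg _) (by positivity)
    exact pow_le_pow_right₀ (by norm_num) (Nat.le_succ k)
  rw [averagedProfile, abs_mul, abs_of_nonneg (by positivity), div_eq_inv_mul, mul_comm 2]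
  exact mul_le_mul_of_nonneg_left ((Finset.abs_sum_le_sum_abs _ _).trans h) (by positivity)

namespace IsProfile

variable {V : ℝ → ℝ} (hV : IsProfile V)
include hV

theorem contDiff_dyadicProfile (k : ℕ) : ContDiff ℝ ∞ (dyadicProfile V k) :=
  contDiff_const.mul (hV.smooth.comp (contDiff_const.mul (contDiff_id.sub contDiff_const)))

theorem deriv_dyadicProfile (k : ℕ) :
    deriv (dyadicProfile V k) = fun s => deriv V (2 ^ (k + 1) * (s - 1)) := funext fun s => by
  have h := ((hasDerivAt_comp_scale (hV.smooth.differentiable (by simp)) k s).const_mul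
    ((2 ^ (k + 1))⁻¹ : ℝ)).deriv
  rw [show dyadicProfile V k = fun s => (2 ^ (k + 1))⁻¹ * V (2 ^ (k + 1) * (s - 1)) from rfl, h]
  field_simp

theorem deriv_deriv_dyadicProfile (k : ℕ) :
    deriv (deriv (dyadicProfile V k)) =
      fun s => deriv (deriv V) (2 ^ (k + 1) * (s - 1)) * 2 ^ (k + 1) := funext fun s => by
  rw [hV.deriv_dyadicProfile,
    (hasDerivAt_comp_scale (hV.contDiff_deriv.differentiable (by simp)) k s).deriv]

theorem contDiff_averagedProfile (N : ℕ) : ContDiff ℝ ∞ (averagedProfile V N) :=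
  contDiff_const.mul (ContDiff.sum fun k _ => hV.contDiff_dyadicProfile k)

theorem deriv_averagedProfile (N : ℕ) : deriv (averagedProfile V N) =
    fun s => (N : ℝ)⁻¹ * ∑ k ∈ Finset.range N, deriv (dyadicProfile V k) s := funext fun s =>
  ((HasDerivAt.fun_sum fun k _ =>
    ((hV.contDiff_dyadicProfile k).differentiable (by simp) s).hasDerivAt).const_mul _).deriv

theorem deriv_deriv_averagedProfile (N : ℕ) : deriv (deriv (averagedProfile V N)) =
    fun s => (N : ℝ)⁻¹ * ∑ k ∈ Finset.range N, deriv (deriv (dyadicProfile V k)) s := by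
  rw [hV.deriv_averagedProfile]
  exact funext fun s => ((HasDerivAt.fun_sum fun k _ =>
    (((contDiff_infty_iff_deriv.1 (hV.contDiff_dyadicProfile k)).2).differentiable
      (by simp) s).hasDerivAt).const_mul _).deriv

theorem deriv_averagedProfile_nonpos (N : ℕ) {s : ℝ} (hs : s ≤ 1) :
    deriv (averagedProfile V N) s ≤ 0 := by
  rw [hV.deriv_averagedProfile]
  refine mul_nonpos_of_nonneg_of_nonpos (by positivity) (Finset.sum_nonpos fun k _ => ?_)
  rw [hV.deriv_dyadicProfile]
  exact hV.deriv_nonpos _ (mul_nonpos_of_nonneg_of_nonpos (by positivity) (by linarith))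

theorem deriv_deriv_averagedProfile_nonpos (N : ℕ) {s : ℝ} (hs : s ≤ 1) :
    deriv (deriv (averagedProfile V N)) s ≤ 0 := by
  rw [hV.deriv_deriv_averagedProfile]
  refine mul_nonpos_of_nonneg_of_nonpos (by positivity) (Finset.sum_nonpos fun k _ => ?_)
  rw [hV.deriv_deriv_dyadicProfile]
  exact mul_nonpos_of_nonpos_of_nonneg (hV.deriv_deriv_nonpos _
    (mul_nonpos_of_nonneg_of_nonpos (by positivity) (by linarith))) (by positivity)

theorem averagedProfile_zero (N : ℕ) : averagedProfile V N 0 = 0 := by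
  refine mul_eq_zero_of_right _ (Finset.sum_eq_zero fun k _ => ?_)
  rw [dyadicProfile, hV.eq_zero_left, mul_zero]
  have : (1 : ℝ) ≤ 2 ^ (k + 1) := one_le_pow₀ (by norm_num)
  linarith

theorem averagedProfile_one_nonpos (N : ℕ) : averagedProfile V N 1 ≤ 0 := by
  have h : AntitoneOn (averagedProfile V N) (Set.Iic 1) :=
    antitoneOn_of_deriv_nonpos (convex_Iic 1) (hV.contDiff_averagedProfile N).continuous.continuousOn
      ((hV.contDiff_averagedProfile N).differentiable (by simp)).differentiableOn fun s hs => by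
        rw [interior_Iic] at hs
        exact hV.deriv_averagedProfile_nonpos N (le_of_lt hs)
  rw [← hV.averagedProfile_zero N]
  exact h (by simp) (by simp) zero_le_one

theorem deriv_averagedProfile_one {N : ℕ} (hN : N ≠ 0) : deriv (averagedProfile V N) 1 = -2 := by
  rw [hV.deriv_averagedProfile]
  simp only [hV.deriv_dyadicProfile, sub_self, mul_zero, hV.deriv_zero, Finset.sum_const,
    Finset.card_range, nsmul_eq_mul]
  field_simp

/-- The areas of the coordinate spheres for the conformal factor `1 + averagedProfile V N` increase
near the centre and decrease near `s = 1`, so they are stationary somewhere in between. -/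
theorem exists_minimal {N : ℕ} (hN : N ≠ 0) : ∃ s₀ : ℝ, 0 < s₀ ∧ s₀ < 1 ∧
    (1 + averagedProfile V N s₀) + s₀ * deriv (averagedProfile V N) s₀ = 0 := by
  set F : ℝ → ℝ := fun s => (1 + averagedProfile V N s) + s * deriv (averagedProfile V N) s with hF
  have hc : Continuous F := (continuous_const.add (hV.contDiff_averagedProfile N).continuous).add
    (continuous_id.mul ((contDiff_infty_iff_deriv.1 (hV.contDiff_averagedProfile N)).2).continuous)
  have h0 : F 0 = 1 := by simp [hF, hV.averagedProfile_zero]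
  have h1 : F 1 < 0 := by
    simp only [hF, hV.deriv_averagedProfile_one hN]
    linarith [hV.averagedProfile_one_nonpos N]
  obtain ⟨s₀, hs, h⟩ := intermediate_value_Icc' zero_le_one hc.continuousOn
    (show (0 : ℝ) ∈ Set.Icc (F 1) (F 0) from ⟨h1.le, by rw [h0]; exact zero_le_one⟩)
  refine ⟨s₀, lt_of_le_of_ne hs.1 fun e => ?_, lt_of_le_of_ne hs.2 fun e => ?_, h⟩
  · rw [← e, h0] at h; exact one_ne_zero h
  · rw [e] at h; exact h1.ne h

end IsProfile

/-! ### Smallness of the superposition -/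

theorem volume_shell_le {δ : ℝ} (h0 : 0 < δ) (h1 : δ ≤ 1) :
    volume (Metric.ball (0 : E3) (1 + δ) \ Metric.ball 0 (1 - δ)) ≤
      ENNReal.ofReal (8 * δ) * volume (Metric.ball (0 : E3) 1) := by
  have hsub : Metric.ball (0 : E3) (1 - δ) ⊆ Metric.ball 0 (1 + δ) :=
    Metric.ball_subset_ball (by linarith)
  have hvol : ∀ r : ℝ, 0 ≤ r → volume (Metric.ball (0 : E3) r) =
      ENNReal.ofReal (r ^ 3) * volume (Metric.ball (0 : E3) 1) := fun r hr => by
    rw [Measure.addHaar_ball _ _ hr, finrank_euclideanSpace_fin]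
  have hfin := measure_ball_lt_top (μ := (volume : Measure E3)) (x := 0) (r := 1)
  rw [measure_sdiff hsub measurableSet_ball.nullMeasurableSet measure_ball_lt_top.ne,
    hvol (1 + δ) (by linarith), hvol (1 - δ) (by linarith), ← ENNReal.sub_mul fun _ _ => hfin.ne,
    ← ENNReal.ofReal_sub _ (pow_nonneg (by linarith) 3)]
  refine mul_le_mul_left (ENNReal.ofReal_le_ofReal ?_) _
  nlinarith [mul_nonneg h0.le (sub_nonneg.2 h1), mul_nonneg (mul_nonneg h0.le (sub_nonneg.2 h1)) h0.le]

theorem lintegral_sq_le_of_shell {f : E3 → ℝ} {δ B : ℝ} (h0 : 0 < δ) (h1 : δ ≤ 1)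
    (hB : ∀ x, |‖x‖ ^ 2 - 1| ≤ δ → |f x| ≤ B) (hf : ∀ x, δ < |‖x‖ ^ 2 - 1| → f x = 0) :
    ∫⁻ x, ‖f x‖ₑ ^ 2 ≤ ENNReal.ofReal (8 * δ * B ^ 2) * volume (Metric.ball (0 : E3) 1) := by
  set S : Set E3 := Metric.ball (0 : E3) (1 + δ) \ Metric.ball 0 (1 - δ) with hS
  have hSm : MeasurableSet S := measurableSet_ball.diff measurableSet_ball
  calc ∫⁻ x, ‖f x‖ₑ ^ 2 ≤ ∫⁻ x, S.indicator (fun _ => ENNReal.ofReal (B ^ 2)) x := by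
        refine lintegral_mono fun x => ?_
        rcases le_or_gt |‖x‖ ^ 2 - 1| δ with h | h
        · have hx : x ∈ S := by
            rw [abs_le] at h
            rw [hS, Set.mem_sdiff, mem_ball_zero_iff, mem_ball_zero_iff, not_lt]
            constructor <;> nlinarith [norm_nonneg x]
          rw [Set.indicator_of_mem hx, ← ofReal_norm, ← ENNReal.ofReal_pow (norm_nonneg _),
            Real.norm_eq_abs]
          exact ENNReal.ofReal_le_ofReal (pow_le_pow_left₀ (abs_nonneg _) (hB x h) 2)
        · simp [hf x h]
    _ = ENNReal.ofReal (B ^ 2) * volume S := by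
        rw [lintegral_indicator hSm, setLIntegral_const]
    _ ≤ ENNReal.ofReal (B ^ 2) * (ENNReal.ofReal (8 * δ) * volume (Metric.ball (0 : E3) 1)) :=
        mul_le_mul_right (volume_shell_le h0 h1) _
    _ = _ := by
        rw [← mul_assoc, ← ENNReal.ofReal_mul (by positivity), mul_comm (B ^ 2)]

/-- The support `[-1, 2]` of the profile, rescaled, lies in `|s - 1| ≤ 2^{-k}`. -/
theorem scale_outside (k : ℕ) {s : ℝ} (hs : ((2 : ℝ) ^ k)⁻¹ < |s - 1|) :
    2 ^ (k + 1) * (s - 1) < -1 ∨ 2 < 2 ^ (k + 1) * (s - 1) := by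
  have hp : (0 : ℝ) < 2 ^ k := by positivity
  rw [inv_lt_iff_one_lt_mul₀ hp] at hs
  rw [pow_succ]
  rcases abs_cases (s - 1) with ⟨h, _⟩ | ⟨h, _⟩
  · right; rw [h] at hs; nlinarith
  · left; rw [h] at hs; nlinarith

theorem deriv_eq_zero_of_outside {W : ℝ → ℝ} (hW : ∀ t, t < -1 ∨ 2 < t → W t = 0) {t : ℝ}
    (ht : t < -1 ∨ 2 < t) : deriv W t = 0 := by
  have hopen : IsOpen {t : ℝ | t < -1 ∨ 2 < t} := isOpen_Iio.union isOpen_Ioi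
  have : W =ᶠ[nhds t] fun _ => 0 := by
    filter_upwards [hopen.mem_nhds ht] with r hr using hW r hr
  rw [this.deriv_eq, deriv_const]

namespace IsProfile

variable {V : ℝ → ℝ} (hV : IsProfile V)
include hV

theorem eq_zero_outside (t : ℝ) (ht : t < -1 ∨ 2 < t) : V t = 0 :=
  ht.elim (fun h => hV.eq_zero_left t h.le) fun h => hV.eq_zero_right t h.le

theorem dyadicProfile_eq_zero (k : ℕ) {s : ℝ} (hs : 2 ≤ s) : dyadicProfile V k s = 0 := by
  have h1 : (2 : ℝ) ≤ 2 ^ (k + 1) := le_self_pow₀ (by norm_num) (Nat.succ_ne_zero k)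
  rw [dyadicProfile, hV.eq_zero_right _ (by nlinarith), mul_zero]

theorem contDiff_radial_dyadicProfile (k : ℕ) :
    ContDiff ℝ ∞ fun x : E3 => dyadicProfile V k (‖x‖ ^ 2) :=
  contDiff_radial (hV.contDiff_dyadicProfile k)

theorem hasCompactSupport_radial_dyadicProfile (k : ℕ) :
    HasCompactSupport fun x : E3 => dyadicProfile V k (‖x‖ ^ 2) := by
  refine HasCompactSupport.of_support_subset_isCompact (isCompact_closedBall (0 : E3) 2)
    fun x hx => ?_
  rw [mem_closedBall_zero_iff]
  by_contra! h
  exact hx (hV.dyadicProfile_eq_zero k (by nlinarith))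

theorem lintegral_dyadicProfile_sq_le {M : ℝ} (hM : ∀ t, |V t| ≤ M) (k : ℕ) :
    ENNReal.ofReal (8 ^ k) * ∫⁻ x : E3, ‖dyadicProfile V k (‖x‖ ^ 2)‖ₑ ^ 2 ≤
      ENNReal.ofReal (8 * M ^ 2) * volume (Metric.ball (0 : E3) 1) := by
  have hp : (1 : ℝ) ≤ 2 ^ k := one_le_pow₀ (by norm_num)
  have hM0 : 0 ≤ M := (abs_nonneg _).trans (hM 0)
  have h := lintegral_sq_le_of_shell (f := fun x : E3 => dyadicProfile V k (‖x‖ ^ 2))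
    (δ := (2 ^ k)⁻¹) (B := (2 ^ k)⁻¹ * M) (by positivity) (inv_le_one_of_one_le₀ hp)
    (fun x _ => by
      rw [dyadicProfile, abs_mul, abs_of_pos (by positivity)]
      exact mul_le_mul (inv_anti₀ (by positivity) (pow_le_pow_right₀ (by norm_num) (Nat.le_succ k)))
        (hM _) (abs_nonneg _) (by positivity))
    (fun x hx => by
      rw [dyadicProfile, hV.eq_zero_outside _ (scale_outside k hx), mul_zero])
  refine (mul_le_mul_right h _).trans (le_of_eq ?_)
  rw [← mul_assoc, ← ENNReal.ofReal_mul (by positivity)]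
  congr 2
  have e8 := eight_pow_eq k
  rw [e8]
  field_simp

theorem lintegral_lap_dyadicProfile_sq_le {M : ℝ} (hM : ∀ t, |deriv V t| ≤ M)
    (hM' : ∀ t, |deriv (deriv V) t| ≤ M) (k : ℕ) :
    ENNReal.ofReal ((2 ^ k)⁻¹) * ∫⁻ x : E3, ‖lap (fun y => dyadicProfile V k (‖y‖ ^ 2)) x‖ₑ ^ 2 ≤
      ENNReal.ofReal (3872 * M ^ 2) * volume (Metric.ball (0 : E3) 1) := by
  have hp : (1 : ℝ) ≤ 2 ^ k := one_le_pow₀ (by norm_num)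
  have hM0 : 0 ≤ M := (abs_nonneg _).trans (hM 0)
  have hlap : ∀ x : E3, lap (fun y => dyadicProfile V k (‖y‖ ^ 2)) x =
      4 * ‖x‖ ^ 2 * (deriv (deriv V) (2 ^ (k + 1) * (‖x‖ ^ 2 - 1)) * 2 ^ (k + 1)) +
        6 * deriv V (2 ^ (k + 1) * (‖x‖ ^ 2 - 1)) := fun x => by
    rw [lap_radial (hV.contDiff_dyadicProfile k), hV.deriv_deriv_dyadicProfile,
      hV.deriv_dyadicProfile]
  have h := lintegral_sq_le_of_shell (f := lap fun y : E3 => dyadicProfile V k (‖y‖ ^ 2))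
    (δ := (2 ^ k)⁻¹) (B := 22 * 2 ^ k * M) (by positivity) (inv_le_one_of_one_le₀ hp)
    (fun x hx => by
      have hx2 : ‖x‖ ^ 2 ≤ 2 := by
        have := (abs_le.1 (hx.trans (inv_le_one_of_one_le₀ hp))).2
        linarith
      rw [hlap]
      refine (abs_add_le _ _).trans ?_
      rw [abs_mul (4 * ‖x‖ ^ 2), abs_mul _ ((2 : ℝ) ^ (k + 1)), abs_mul 6,
        abs_of_nonneg (by positivity : (0 : ℝ) ≤ 4 * ‖x‖ ^ 2),
        abs_of_pos (by positivity : (0 : ℝ) < 2 ^ (k + 1)), abs_of_pos (by norm_num : (0 : ℝ) < 6),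
        pow_succ 2 k]
      have h1 : 4 * ‖x‖ ^ 2 * (|deriv (deriv V) (2 ^ k * 2 * (‖x‖ ^ 2 - 1))| * (2 ^ k * 2)) ≤
          4 * 2 * (M * (2 ^ k * 2)) := by
        gcongr
        exact hM' _
      have h2 := hM (2 ^ k * 2 * (‖x‖ ^ 2 - 1))
      have h3 : M ≤ 2 ^ k * M := le_mul_of_one_le_left hM0 hp
      linarith)
    (fun x hx => by
      have ho := scale_outside k hx
      rw [hlap, deriv_eq_zero_of_outside hV.eq_zero_outside ho, deriv_eq_zero_of_outside
        (fun t ht => deriv_eq_zero_of_outside hV.eq_zero_outside ht) ho]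
      ring)
  refine (mul_le_mul_right h _).trans (le_of_eq ?_)
  rw [← mul_assoc, ← ENNReal.ofReal_mul (by positivity)]
  congr 2
  field_simp
  ring

end IsProfile

/-! ### Sobolev norms on the unit ball -/

namespace LPCutoff

theorem hsNormOn_le (η : LPCutoff) {s : ℝ} {Ω : Set E3} {f u : E3 → ℝ}
    (hu : MemLp (fun x => (u x : ℂ)) 2 (volume : Measure E3)) (h : ∀ x ∈ Ω, u x = f x) :
    η.hsNormOn s Ω f ≤ η.hsNorm s hu.toLp :=
  iInf_le_of_le u (iInf_le_of_le hu (iInf_le _ h))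

theorem hsNorm_le_of_sq_le (η : LPCutoff) {s e : ℝ} {f : Lp (α := E3) ℂ 2} (he : 0 ≤ e)
    (h : η.hsNorm s f ^ 2 ≤ ENNReal.ofReal (e ^ 2)) : η.hsNorm s f ≤ ENNReal.ofReal e := by
  rw [ENNReal.ofReal_pow he] at h
  exact (ENNReal.pow_le_pow_left_iff two_ne_zero).1 h

theorem hsNormOn_zero (η : LPCutoff) {s : ℝ} (hs : s ≤ 3 / 2) (Ω : Set E3) :
    η.hsNormOn s Ω (fun _ => 0) = 0 := by
  have hu : MemLp (fun x : E3 => ((0 * ∑ k ∈ Finset.range 0, (fun _ _ => 0 : ℕ → E3 → ℝ) k x : ℝ) : ℂ))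
      2 volume := by simp
  have h := η.hsNorm_sum_sq_le hs 0 0 (fun _ _ => 0) (fun _ => contDiff_const)
    (fun _ => HasCompactSupport.zero) hu
  have h' := pow_eq_zero_iff two_ne_zero |>.1 (nonpos_iff_eq_zero.1
    (h.trans_eq (by rw [Finset.sum_range_zero, mul_zero])))
  exact nonpos_iff_eq_zero.1 ((η.hsNormOn_le hu fun x _ => by simp).trans h'.le)

theorem tensorHsNormOn_scalar (η : LPCutoff) {s : ℝ} (hs : s ≤ 3 / 2) (Ω : Set E3) (f : E3 → ℝ) :
    η.tensorHsNormOn s Ω (fun x => f x • 1) = 3 * η.hsNormOn s Ω f := by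
  have h : ∀ i j : Fin 3, η.hsNormOn s Ω (fun x => (f x • (1 : Matrix (Fin 3) (Fin 3) ℝ)) i j) =
      if i = j then η.hsNormOn s Ω f else 0 := fun i j => by
    split_ifs with hij
    · simp [hij]
    · simp [hij, η.hsNormOn_zero hs]
  simp only [tensorHsNormOn, h]
  simp

end LPCutoff

theorem memLp_ofReal_comp {v : E3 → ℝ} (hv : Continuous v) (hc : HasCompactSupport v) :
    MemLp (fun x => (v x : ℂ)) 2 (volume : Measure E3) :=
  (Complex.continuous_ofReal.comp hv).memLp_of_hasCompactSupport
    (hc.comp_left (g := ((↑) : ℝ → ℂ)) Complex.ofReal_zero)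

theorem lintegral_enorm_sq_lt_top {v : E3 → ℝ} (hv : Continuous v) (hc : HasCompactSupport v) :
    ∫⁻ x, ‖v x‖ₑ ^ 2 < ⊤ := by
  have h := LPCutoff.enorm_toLp_sq (memLp_ofReal_comp hv hc)
  simp only [enorm_ofReal] at h
  rw [← h]
  exact ENNReal.pow_lt_top enorm_lt_top

theorem hasCompactSupport_lap {v : E3 → ℝ} (hc : HasCompactSupport v) : HasCompactSupport (lap v) := by
  have hpd : ∀ {w : E3 → ℝ} (i : Fin 3), HasCompactSupport w → HasCompactSupport (pd i w) :=
    fun i hw => hw.fderiv_apply ℝ _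
  exact HasCompactSupport.of_support_subset_isCompact
    (isCompact_iUnion fun i : Fin 3 => hpd i (hpd i hc)) fun x hx => by
      rw [Function.mem_support, lap] at hx
      obtain ⟨i, -, hi⟩ := Finset.exists_ne_zero_of_sum_ne_zero hx
      exact Set.mem_iUnion.2 ⟨i, subset_tsupport _ hi⟩

theorem continuous_lap {v : E3 → ℝ} (hv : ContDiff ℝ ∞ v) : Continuous (lap v) :=
  continuous_finsetSum _ fun i _ => (contDiff_pd (contDiff_pd hv i) i).continuous

/-- Every smooth compactly supported function becomes small in `H^s`, `s ≤ 3/2`, after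
multiplication by a small constant. -/
theorem LPCutoff.exists_hsNorm_mul_le (η : LPCutoff) {s : ℝ} (hs : s ≤ 3 / 2) {v : E3 → ℝ}
    (hv : ContDiff ℝ ∞ v) (hc : HasCompactSupport v) {e : ℝ} (he : 0 < e) :
    ∃ β : ℝ, 0 < β ∧ ∃ hu : MemLp (fun x => ((-β * v x : ℝ) : ℂ)) 2 (volume : Measure E3),
      η.hsNorm s hu.toLp ≤ ENNReal.ofReal e := by
  obtain ⟨d, hd⟩ : ∃ d : ℝ, (∫⁻ x, ‖lap v x‖ₑ ^ 2) + ∫⁻ x, ‖v x‖ₑ ^ 2 = ENNReal.ofReal d :=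
    ⟨_, (ENNReal.ofReal_toReal (ENNReal.add_lt_top.2
      ⟨lintegral_enorm_sq_lt_top (continuous_lap hv) (hasCompactSupport_lap hc),
        lintegral_enorm_sq_lt_top hv.continuous hc⟩).ne).symm⟩
  set q : ℝ := |d| + 1 with hq
  have hq1 : 1 ≤ q := by rw [hq]; linarith [abs_nonneg d]
  have hdq : d ≤ q := by rw [hq]; linarith [le_abs_self d]
  -- `3602 ≤ 61 ^ 2`
  set β : ℝ := e / (61 * q) with hβ
  have hβ0 : 0 < β := by positivity
  have hu : MemLp (fun x => ((-β * v x : ℝ) : ℂ)) 2 (volume : Measure E3) :=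
    memLp_ofReal_comp (continuous_const.mul hv.continuous) hc.mul_left
  refine ⟨β, hβ0, hu, η.hsNorm_le_of_sq_le he.le ?_⟩
  have hu' : MemLp (fun x => ((-β * ∑ k ∈ Finset.range 1, (fun _ => v : ℕ → E3 → ℝ) k x : ℝ) : ℂ))
      2 (volume : Measure E3) := by simpa using hu
  have h := η.hsNorm_sum_sq_le hs 1 (-β) (fun _ => v) (fun _ => hv) (fun _ => hc) hu'
  simp only [Finset.range_one, Finset.sum_singleton, pow_zero, inv_one, ENNReal.ofReal_one,
    one_mul] at h
  refine h.trans ?_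
  rw [hd, ← ENNReal.ofReal_mul (by positivity)]
  refine ENNReal.ofReal_le_ofReal ?_
  have h1 : β * (61 * q) = e := by rw [hβ]; field_simp
  calc 3602 * (-β) ^ 2 * d ≤ 3602 * (-β) ^ 2 * q := by gcongr
    _ ≤ 3602 * (-β) ^ 2 * q ^ 2 := by gcongr; nlinarith
    _ ≤ e ^ 2 := by rw [← h1]; nlinarith [sq_nonneg (β * q)]

namespace IsProfile

variable {V : ℝ → ℝ} (hV : IsProfile V)
include hV

theorem contDiff_radial_averagedProfile (N : ℕ) :
    ContDiff ℝ ∞ fun x : E3 => averagedProfile V N (‖x‖ ^ 2) :=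
  contDiff_radial (hV.contDiff_averagedProfile N)

theorem hasCompactSupport_radial_averagedProfile (N : ℕ) :
    HasCompactSupport fun x : E3 => averagedProfile V N (‖x‖ ^ 2) := by
  refine HasCompactSupport.of_support_subset_isCompact (isCompact_closedBall (0 : E3) 2)
    fun x hx => ?_
  rw [mem_closedBall_zero_iff]
  by_contra! h
  refine hx (mul_eq_zero_of_right _ (Finset.sum_eq_zero fun k _ => ?_))
  exact hV.dyadicProfile_eq_zero k (by nlinarith)

/-- The averaged profile tends to `0` in `H^{3/2}`. -/
theorem exists_hsNorm_averagedProfile_le (η : LPCutoff) {e : ℝ} (he : 0 < e) :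
    ∃ N₀ : ℕ, ∀ N ≥ N₀, N ≠ 0 → ∃ hu : MemLp
      (fun x => ((averagedProfile V N (‖x‖ ^ 2) : ℝ) : ℂ)) 2 (volume : Measure E3),
      η.hsNorm (3 / 2) hu.toLp ≤ ENNReal.ofReal e := by
  obtain ⟨M, hM0, hM⟩ := hV.exists_bound
  set κ : ℝ := 3880 * M ^ 2 * (volume (Metric.ball (0 : E3) 1)).toReal with hκ
  have hvol : volume (Metric.ball (0 : E3) 1) =
      ENNReal.ofReal (volume (Metric.ball (0 : E3) 1)).toReal :=
    (ENNReal.ofReal_toReal measure_ball_lt_top.ne).symm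
  have hκ0 : 0 ≤ κ := by positivity
  obtain ⟨N₀, hN₀⟩ := exists_nat_ge (3602 * κ / e ^ 2)
  -- Each of the `N` scales contributes at most `κ`, and the average carries the factor `N⁻²`.
  refine ⟨N₀, fun N hN hN0 => ⟨memLp_ofReal_comp (hV.contDiff_radial_averagedProfile N).continuous
    (hV.hasCompactSupport_radial_averagedProfile N), η.hsNorm_le_of_sq_le he.le ?_⟩⟩
  refine (η.hsNorm_sum_sq_le le_rfl N (N : ℝ)⁻¹ (fun k x => dyadicProfile V k (‖x‖ ^ 2))
    hV.contDiff_radial_dyadicProfile hV.hasCompactSupport_radial_dyadicProfile _).trans ?_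
  have hterm : ∀ k ∈ Finset.range N,
      (ENNReal.ofReal ((2 ^ k)⁻¹) * (∫⁻ x : E3, ‖lap (fun y => dyadicProfile V k (‖y‖ ^ 2)) x‖ₑ ^ 2) +
        ENNReal.ofReal (8 ^ k) * ∫⁻ x : E3, ‖dyadicProfile V k (‖x‖ ^ 2)‖ₑ ^ 2) ≤
      ENNReal.ofReal κ := fun k _ => by
    refine (add_le_add (hV.lintegral_lap_dyadicProfile_sq_le (fun t => (hM t).2.1)
      (fun t => (hM t).2.2) k) (hV.lintegral_dyadicProfile_sq_le (fun t => (hM t).1) k)).trans ?_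
    rw [← add_mul, ← ENNReal.ofReal_add (by positivity) (by positivity), hvol,
      ← ENNReal.ofReal_mul (by positivity)]
    exact ENNReal.ofReal_le_ofReal (le_of_eq (by rw [hκ]; ring))
  refine (mul_le_mul_right (Finset.sum_le_sum hterm) _).trans ?_
  rw [Finset.sum_const, Finset.card_range, nsmul_eq_mul, ← ENNReal.ofReal_natCast,
    ← ENNReal.ofReal_mul (by positivity), ← ENNReal.ofReal_mul (by positivity)]
  refine ENNReal.ofReal_le_ofReal ?_
  have hNpos : (0 : ℝ) < N := by positivity
  have hN' : 3602 * κ / e ^ 2 ≤ N := hN₀.trans (by exact_mod_cast hN)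
  rw [div_le_iff₀ (by positivity)] at hN'
  have : 3602 * (N : ℝ)⁻¹ ^ 2 * (N * κ) = 3602 * κ / N := by field_simp
  rw [this, div_le_iff₀ hNpos]
  linarith

end IsProfile

/-- The parameters are chosen in the order `N`, `β`: the number `N` of scales makes the metric close
to `e`, and with a minimal sphere at hand every `β > 0` gives a trapped one. -/
theorem exists_small_trapped_data (η : LPCutoff) {e : ℝ} (he : 0 < e) :
    ∃ (g k : Tensor2) (ψ₀ ψ₁ : E3 → ℝ), IsInitialData unitBall g k ψ₀ ψ₁ ∧
      IsSphericallySymmetric g k ψ₀ ψ₁ ∧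
      η.tensorHsNormOn (3 / 2) unitBall (fun x => g x - 1) +
        η.tensorHsNormOn (1 / 2) unitBall k ≤ ENNReal.ofReal (6 * e) ∧
      ∃ Φ : S2 → E3, IsTrappedSphere unitBall g k Φ := by
  obtain ⟨V, hV⟩ := exists_isProfile
  obtain ⟨M, hM0, hM⟩ := hV.exists_bound
  obtain ⟨N₀, hN₀⟩ := hV.exists_hsNorm_averagedProfile_le η he
  obtain ⟨N₁, hN₁⟩ := exists_nat_gt (2 * M)
  set N : ℕ := max N₀ N₁ with hN
  have hNM : 2 * M < N := hN₁.trans_le (by exact_mod_cast le_max_right _ _)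
  have hNpos : (0 : ℝ) < N := by linarith
  have hN0 : N ≠ 0 := by rintro h; rw [h] at hNpos; simp at hNpos
  obtain ⟨hu, hsmall⟩ := hN₀ N (le_max_left _ _) hN0
  set v : ℝ → ℝ := averagedProfile V N with hv
  set Φ : ℝ → ℝ := fun s => 1 + v s with hΦdef
  have hvs : ContDiff ℝ ∞ v := hV.contDiff_averagedProfile N
  have hΦ : ContDiff ℝ ∞ Φ := contDiff_const.add hvs
  have hpos : ∀ s, 0 < Φ s := fun s => by
    have h1 := abs_averagedProfile_le (fun t => (hM t).1) N s
    have h2 : 2 * M / N < 1 := by rwa [div_lt_one hNpos]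
    have h3 := (abs_le.1 h1).1
    simp only [hΦdef, hv]
    linarith
  have hd : deriv Φ = deriv v := funext fun s => deriv_const_add _
  -- `Φ(|x|²)` is not in `L²`; the bump `χ` replaces its constant part `1` outside the ball.
  let χ : ContDiffBump (0 : E3) := ⟨1, 2, one_pos, one_lt_two⟩
  have hχ : ∀ x ∈ unitBall, χ x = 1 := fun x hx =>
    χ.one_of_mem_closedBall (Metric.ball_subset_closedBall hx)
  obtain ⟨β, hβ, hk, hksmall⟩ := η.exists_hsNorm_mul_le (s := 1 / 2) (by norm_num)
    (v := fun x => χ x + v (‖x‖ ^ 2)) (χ.contDiff.add (hV.contDiff_radial_averagedProfile N))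
    (χ.hasCompactSupport.add (hV.hasCompactSupport_radial_averagedProfile N)) he
  obtain ⟨s₀, h0, h1, hmin⟩ := hV.exists_minimal hN0
  refine ⟨confMetric Φ, fun x => -β • confMetric Φ x, fun _ => 0,
    fun x => √(radialCurvature Φ (‖x‖ ^ 2) + 6 * β ^ 2),
    isInitialData_confMetric hΦ hpos (fun s _ hs => ?_) (fun s _ hs => ?_) hβ,
    isSphericallySymmetric_confMetric Φ β fun s => √(radialCurvature Φ s + 6 * β ^ 2), ?_,
    _, isTrappedSphere_confMetric hΦ hpos h0 h1 (by rw [hd]; exact hmin) hβ⟩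
  · rw [hd]; exact hV.deriv_averagedProfile_nonpos N hs.le
  · rw [hd]; exact hV.deriv_deriv_averagedProfile_nonpos N hs.le
  · have e1 : (fun x => confMetric Φ x - 1) = fun x => v (‖x‖ ^ 2) • 1 := funext fun x => by
      rw [confMetric, hΦdef, add_smul, one_smul, add_sub_cancel_left]
    have e2 : (fun x => -β • confMetric Φ x) = fun x => (-β * Φ (‖x‖ ^ 2)) • 1 := funext fun x => by
      rw [confMetric, smul_smul]
    rw [e1, e2, η.tensorHsNormOn_scalar le_rfl, η.tensorHsNormOn_scalar (by norm_num), ← mul_add,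
      show 6 * e = 3 * (e + e) by ring, ENNReal.ofReal_mul (by norm_num),
      ENNReal.ofReal_add he.le he.le, ENNReal.ofReal_ofNat]
    refine mul_le_mul_right (add_le_add ?_ ?_) _
    · exact (η.hsNormOn_le hu fun x _ => rfl).trans hsmall
    · exact (η.hsNormOn_le hk fun x hx => by rw [hχ x hx]).trans hksmall

end EinsteinScalar

open EinsteinScalar
theorem proposition3 (η : LPCutoff) :
    ∃ (g k : ℕ → Tensor2) (ψ₀ ψ₁ : ℕ → E3 → ℝ), ∀ j : ℕ, 1 ≤ j →
      IsInitialData unitBall (g j) (k j) (ψ₀ j) (ψ₁ j) ∧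
      IsSphericallySymmetric (g j) (k j) (ψ₀ j) (ψ₁ j) ∧
      η.tensorHsNormOn (3 / 2) unitBall (fun x => g j x - 1) +
          η.tensorHsNormOn (1 / 2) unitBall (k j) ≤ (2⁻¹ : ENNReal) ^ j ∧
      ∃ Φ : S2 → E3, IsTrappedSphere unitBall (g j) (k j) Φ := by
  choose g k ψ₀ ψ₁ h using fun j : ℕ =>
    exists_small_trapped_data η (e := (2⁻¹ : ℝ) ^ j / 6) (by positivity)
  refine ⟨g, k, ψ₀, ψ₁, fun j _ => ⟨(h j).1, (h j).2.1, (h j).2.2.1.trans_eq ?_, (h j).2.2.2⟩⟩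
  rw [mul_div_cancel₀ _ (by norm_num), ENNReal.ofReal_pow (by norm_num),
    ENNReal.ofReal_inv_of_pos two_pos, ENNReal.ofReal_ofNat]
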